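/- Let $n\ge 1$, let $\mathbb T$ be the unit circle with normalised Lebesgue measure, and for $1\le s\le\infty$ let $(L^s)^n$ be the space of column vectors with $n$ entries in $L^s(\mathbb T)$, let $(H^s)^n\subseteq (L^s)^n$ be the Hardy space (vanishing Fourier coefficients of negative index), and let $(\overline{H^s_0})^n=\{\bar f: f\in (H^s)^n,\ f(0)=0\}$. For $1<s<\infty$ let $P_{s+}:(L^s)^n\to (H^s)^n$ be the Riesz projection, i.e. the projection onto $(H^s)^n$ along $(\overline{H^s_0})^n$. Let $\Theta$ be an $n\times n$ inner function (entries in $H^\infty$, $\Theta(z)$ unitary for almost every $z\in\mathbb T$), let $K_\Theta=\Theta(\overline{H^2_0})^n\cap (H^2)^n$ be the model space with the norm of $(L^2)^n$, and let $P_\Theta$ be the orthogonal projection of $(L^2)^n$ onto $K_\Theta$. Let $p\in(2,\infty]$, let $q\in(1,2]$ be given by $\frac1q=\frac12+\frac1p$, and let $G$ be an $n\times n$ matrix function with entries in $L^p(\mathbb T)$. Assume that the map $f\mapsto P_\Theta(Gf)$, defined on the dense subspace $K_\Theta\cap (H^\infty)^n$ of $K_\Theta$, is bounded for the $(L^2)^n$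 norm, and let $A_G^\Theta:K_\Theta\to K_\Theta$ be its bounded extension (the matrix-valued truncated Toeplitz operator with symbol $G$). Direct sums of Banach spaces carry the norm $\|x\|+\|y\|$. Let $$\text{Co-d}=\left\{\begin{pmatrix}0\\ \Theta p_1\end{pmatrix}+\begin{pmatrix}0\\ p_2\end{pmatrix}+\begin{pmatrix}p_3\\ P_{q+}(G\Theta p_3)\end{pmatrix}: p_1\in (H^q)^n,\ p_2\in K_\Theta,\ p_3\in (H^2)^n\right\},$$ with the (well defined) norm $\|\Theta p_1\|_{(H^q)^n}+\|p_2\|_{K_\Theta}+\|p_3\|_{(H^2)^n}$. Then Co-d is a Banach space, the formula $$T_{\mathcal G}^r\begin{pmatrix}f_1\\ f_2\end{pmatrix}=\begin{pmatrix}P_{2+}(\Theta^* f_1)\\ P_{q+}(Gf_1+\Theta f_2)\end{pmatrix}$$ defines a bounded operator $T_{\mathcal G}^r:(H^2)^n\oplus (H^q)^n\to\text{Co-d}$ (the Toeplitz operator with block symbol $\mathcal G=\begin{pmatrix}\Theta^*&0\\ G&\Theta\end{pmatrix}$ and restricted codomain), and $A_G^\Theta$ is equivalent after extension to $T_{\mathcal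 G}^r$: there are (possibly trivial) Banach spaces $X_0,Y_0$ and boundedly invertible linear operators $E:\text{Co-d}\oplus Y_0\to K_\Theta\oplus X_0$ and $F:K_\Theta\oplus X_0\to \big((H^2)^n\oplus (H^q)^n\big)\oplus Y_0$ with $$\begin{pmatrix}A_G^\Theta&0\\0&I_{X_0}\end{pmatrix}=E\begin{pmatrix}T_{\mathcal G}^r&0\\0&I_{Y_0}\end{pmatrix}F.$$ -/

import Mathlib

open MeasureTheory Matrix
open scoped ENNReal

noncomputable section

namespace MTTO

/-- The unit circle, parametrised by the angle: `t` stands for the point `z = exp (i t)`. -/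
abbrev Circ : Type := AddCircle (2 * Real.pi)

instance instFactTwoPi : Fact (0 < 2 * Real.pi) := ⟨Real.two_pi_pos⟩

/-- Normalised Lebesgue (Haar) measure on the circle. -/
abbrev mC : Measure Circ := AddCircle.haarAddCircle

/-- `ℂⁿ` with its Euclidean norm. -/
abbrev Cn (n : ℕ) : Type := EuclideanSpace ℂ (Fin n)

/-- `(L^s)ⁿ`: column vectors of length `n` with entries in `L^s` of the circle. -/
abbrev LpVec (n : ℕ) (s : ℝ≥0∞) : Type := Lp (Cn n) s mC

/-- `M ∈ L^{(s, n × n)}`: every entry of the matrix function `M` lies in `L^s`. -/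
def MatrixMemLp {n : ℕ} (M : Circ → Matrix (Fin n) (Fin n) ℂ) (s : ℝ≥0∞) : Prop :=
  ∀ i j, MemLp (fun t => M t i j) s mC

/-- The pointwise product `t ↦ M t f(t)` of a matrix function and a vector function. -/
def mulVecFun {n : ℕ} (M : Circ → Matrix (Fin n) (Fin n) ℂ) (f : Circ → Cn n) : Circ → Cn n :=
  fun t => WithLp.toLp 2 (M t *ᵥ WithLp.ofLp (f t))

/-- The pointwise adjoint `M^*`. -/
def adj {n : ℕ} (M : Circ → Matrix (Fin n) (Fin n) ℂ) : Circ → Matrix (Fin n) (Fin n) ℂ :=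
  fun t => (M t)ᴴ

theorem MatrixMemLp.mono {n : ℕ} {M : Circ → Matrix (Fin n) (Fin n) ℂ} {s r : ℝ≥0∞}
    (hM : MatrixMemLp M s) (h : r ≤ s) : MatrixMemLp M r :=
  fun i j => (hM i j).mono_exponent h

theorem MatrixMemLp.adj {n : ℕ} {M : Circ → Matrix (Fin n) (Fin n) ℂ} {s : ℝ≥0∞}
    (hM : MatrixMemLp M s) : MatrixMemLp (adj M) s :=
  fun i j => by
    have := (hM j i).star
    exact this

theorem MatrixMemLp.mulVecFun {n : ℕ} {M : Circ → Matrix (Fin n) (Fin n) ℂ} {a b c : ℝ≥0∞}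
    [ENNReal.HolderTriple a b c] (hM : MatrixMemLp M a) {f : Circ → Cn n} (hf : MemLp f b mC) :
    MemLp (mulVecFun M f) c mC := by
  refine MemLp.of_eval_piLp fun i => ?_
  have h : MemLp (fun t => ∑ j, M t i j * f t j) c mC :=
    memLp_finsetSum _ fun j _ => (hf.eval_piLp j).mul (hM i j)
  exact h

/-- Multiplication by `M ∈ L^{(a, n × n)}` as a linear map `(L^b)ⁿ → (L^c)ⁿ`, `1/a + 1/b = 1/c`. -/
def mulLp {n : ℕ} {M : Circ → Matrix (Fin n) (Fin n) ℂ} {a : ℝ≥0∞} (hM : MatrixMemLp M a)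
    (b c : ℝ≥0∞) [ENNReal.HolderTriple a b c] : LpVec n b →ₗ[ℂ] LpVec n c where
  toFun f := (hM.mulVecFun (Lp.memLp f)).toLp _
  map_add' f g := by
    rw [← MemLp.toLp_add]
    refine MemLp.toLp_congr _ _ ?_
    filter_upwards [Lp.coeFn_add f g] with t ht
    rw [mulVecFun, ht]
    simp [mulVecFun, Matrix.mulVec_add]
  map_smul' z f := by
    rw [RingHom.id_apply, ← MemLp.toLp_const_smul]
    refine MemLp.toLp_congr _ _ ?_
    filter_upwards [Lp.coeFn_smul z f] with t ht
    rw [mulVecFun, ht]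
    simp [mulVecFun, Matrix.mulVec_smul]

theorem coeFn_mulLp {n : ℕ} {M : Circ → Matrix (Fin n) (Fin n) ℂ} {a : ℝ≥0∞}
    (hM : MatrixMemLp M a) (b c : ℝ≥0∞) [ENNReal.HolderTriple a b c] (f : LpVec n b) :
    mulLp hM b c f =ᵐ[mC] mulVecFun M f :=
  MemLp.coeFn_toLp (hM.mulVecFun (Lp.memLp f))

theorem integrable_LpVec {n : ℕ} {s : ℝ≥0∞} [hs : Fact (1 ≤ s)] (f : LpVec n s) :
    Integrable f mC :=
  (Lp.memLp f).integrable hs.out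

/-- The `k`-th Fourier coefficient as a linear map on `(L^s)ⁿ`. -/
def coeffLin (n : ℕ) (s : ℝ≥0∞) [Fact (1 ≤ s)] (k : ℤ) : LpVec n s →ₗ[ℂ] Cn n where
  toFun f := fourierCoeff f k
  map_add' f g := by
    rw [fourierCoeff_congr_ae (Lp.coeFn_add f g),
      fourierCoeff.add (integrable_LpVec f) (integrable_LpVec g)]
    rfl
  map_smul' z f := by
    rw [fourierCoeff_congr_ae (Lp.coeFn_smul z f), fourierCoeff.const_smul]
    rfl

/-- The Hardy space `(H^s)ⁿ` on the circle: the functions in `(L^s)ⁿ` all of whose Fourier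
coefficients of negative index vanish. -/
def hardy (n : ℕ) (s : ℝ≥0∞) [Fact (1 ≤ s)] : Submodule ℂ (LpVec n s) :=
  ⨅ k : {k : ℤ // k < 0}, LinearMap.ker (coeffLin n s k)

/-- The space of complex conjugates of the functions `f ∈ (H^s)ⁿ` with `f(0) = 0`: the functions
in `(L^s)ⁿ` all of whose Fourier coefficients of index `≥ 0` vanish. -/
def conjHardyZero (n : ℕ) (s : ℝ≥0∞) [Fact (1 ≤ s)] : Submodule ℂ (LpVec n s) :=
  ⨅ k : {k : ℤ // 0 ≤ k}, LinearMap.ker (coeffLin n s k)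

theorem mem_hardy {n : ℕ} {s : ℝ≥0∞} [Fact (1 ≤ s)] {f : LpVec n s} :
    f ∈ hardy n s ↔ ∀ k : ℤ, k < 0 → fourierCoeff f k = 0 := by
  simp [hardy, coeffLin]

theorem mem_conjHardyZero {n : ℕ} {s : ℝ≥0∞} [Fact (1 ≤ s)] {f : LpVec n s} :
    f ∈ conjHardyZero n s ↔ ∀ k : ℤ, 0 ≤ k → fourierCoeff f k = 0 := by
  simp [conjHardyZero, coeffLin]

/-- `g = P_{s+} f`, where `P_{s+}` is the Riesz projection, that is, the projection of `(L^s)ⁿ`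
onto `(H^s)ⁿ` along the conjugates of the functions in `(H^s)ⁿ` that vanish at `0`. -/
def IsRieszProj {n : ℕ} {s : ℝ≥0∞} [Fact (1 ≤ s)] (f g : LpVec n s) : Prop :=
  g ∈ hardy n s ∧ f - g ∈ conjHardyZero n s

/-- `Θ` is an `n × n` inner function. -/
structure IsInner {n : ℕ} (Θ : Circ → Matrix (Fin n) (Fin n) ℂ) : Prop where
  memLp : MatrixMemLp Θ ∞
  analytic : ∀ i j, ∀ k : ℤ, k < 0 → fourierCoeff (fun t => Θ t i j) k = 0
  unitary : ∀ᵐ t ∂mC, Θ t ∈ Matrix.unitaryGroup (Fin n) ℂ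

/-- Multiplication by the inner function `Θ` on `(L^s)ⁿ`. -/
def mulInner {n : ℕ} {Θ : Circ → Matrix (Fin n) (Fin n) ℂ} (hΘ : IsInner Θ) (s : ℝ≥0∞) :
    LpVec n s →ₗ[ℂ] LpVec n s :=
  mulLp hΘ.memLp s s

/-- Multiplication by `Θ^*` on `(L^s)ⁿ`. -/
def mulInnerAdj {n : ℕ} {Θ : Circ → Matrix (Fin n) (Fin n) ℂ} (hΘ : IsInner Θ) (s : ℝ≥0∞) :
    LpVec n s →ₗ[ℂ] LpVec n s :=
  mulLp hΘ.memLp.adj s s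

/-- The model space `K_Θ = Θ (conjugates of (H²_0)ⁿ) ∩ (H²)ⁿ`, with the norm of `(L²)ⁿ`. -/
def modelSpace {n : ℕ} {Θ : Circ → Matrix (Fin n) (Fin n) ℂ} (hΘ : IsInner Θ) :
    Submodule ℂ (LpVec n 2) :=
  (conjHardyZero n 2).map (mulInner hΘ 2) ⊓ hardy n 2

/-! ### `K_Θ` is closed, so that it has an orthogonal projection -/

theorem norm_mulVecFun_of_unitary {n : ℕ} {M : Matrix (Fin n) (Fin n) ℂ}
    (hM : M ∈ Matrix.unitaryGroup (Fin n) ℂ) (v : Cn n) :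
    ‖(WithLp.toLp 2 (M *ᵥ WithLp.ofLp v) : Cn n)‖ = ‖v‖ := by
  have h : ‖(WithLp.toLp 2 (M *ᵥ WithLp.ofLp v) : Cn n)‖ ^ 2 = ‖v‖ ^ 2 := by
    have key : ∀ w : Cn n, ((‖w‖ ^ 2 : ℝ) : ℂ) = star (WithLp.ofLp w) ⬝ᵥ WithLp.ofLp w := by
      intro w
      rw [EuclideanSpace.norm_sq_eq]
      simp only [dotProduct, Pi.star_apply, RCLike.star_def, Complex.ofReal_sum,
        Complex.ofReal_pow]
      exact Finset.sum_congr rfl fun i _ => (Complex.conj_mul' _).symm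
    have e : ((‖(WithLp.toLp 2 (M *ᵥ WithLp.ofLp v) : Cn n)‖ ^ 2 : ℝ) : ℂ) =
        ((‖v‖ ^ 2 : ℝ) : ℂ) := by
      rw [key, key]
      simp only [Matrix.star_mulVec]
      rw [← Matrix.dotProduct_mulVec, Matrix.mulVec_mulVec, ← Matrix.star_eq_conjTranspose,
        (Unitary.mem_iff.1 hM).1, Matrix.one_mulVec]
    exact_mod_cast e
  exact (sq_eq_sq₀ (norm_nonneg _) (norm_nonneg _)).1 h

theorem norm_mulInner {n : ℕ} {Θ : Circ → Matrix (Fin n) (Fin n) ℂ} (hΘ : IsInner Θ)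
    (s : ℝ≥0∞) (f : LpVec n s) : ‖mulInner hΘ s f‖ = ‖f‖ := by
  rw [Lp.norm_def, Lp.norm_def]
  congr 1
  refine eLpNorm_congr_norm_ae ?_
  filter_upwards [coeFn_mulLp hΘ.memLp s s f, hΘ.unitary] with t ht hu
  rw [mulInner, ht]
  exact norm_mulVecFun_of_unitary hu _

theorem norm_coeffLin_le {n : ℕ} {s : ℝ≥0∞} [hs : Fact (1 ≤ s)] (k : ℤ) (f : LpVec n s) :
    ‖coeffLin n s k f‖ ≤ 1 * ‖f‖ := by
  have h1 : ‖fourierCoeff f k‖ ≤ ∫ t, ‖f t‖ ∂mC := by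
    refine (norm_integral_le_integral_norm _).trans (le_of_eq ?_)
    refine integral_congr_ae (Filter.Eventually.of_forall fun t => ?_)
    change ‖fourier (-k) t • f t‖ = ‖f t‖
    rw [norm_smul, fourier_apply, Circle.norm_coe, one_mul]
  have h2 : ∫ t, ‖f t‖ ∂mC = (eLpNorm f 1 mC).toReal := by
    rw [eLpNorm_one_eq_lintegral_enorm,
      integral_norm_eq_lintegral_enorm (integrable_LpVec f).aestronglyMeasurable]
  have h3 : (eLpNorm f 1 mC).toReal ≤ (eLpNorm f s mC).toReal :=
    ENNReal.toReal_mono (Lp.memLp f).eLpNorm_ne_top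
      (eLpNorm_le_eLpNorm_of_exponent_le hs.out (Lp.aestronglyMeasurable f))
  rw [one_mul, Lp.norm_def]
  exact h1.trans (h2.le.trans h3)

theorem continuous_coeffLin (n : ℕ) (s : ℝ≥0∞) [Fact (1 ≤ s)] (k : ℤ) :
    Continuous (coeffLin n s k) :=
  AddMonoidHomClass.continuous_of_bound _ 1 (norm_coeffLin_le k)

theorem isClosed_hardy (n : ℕ) (s : ℝ≥0∞) [Fact (1 ≤ s)] :
    IsClosed (hardy n s : Set (LpVec n s)) := by
  rw [hardy, Submodule.coe_iInf]
  exact isClosed_iInter fun k => isClosed_singleton.preimage (continuous_coeffLin n s k)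

theorem isClosed_conjHardyZero (n : ℕ) (s : ℝ≥0∞) [Fact (1 ≤ s)] :
    IsClosed (conjHardyZero n s : Set (LpVec n s)) := by
  rw [conjHardyZero, Submodule.coe_iInf]
  exact isClosed_iInter fun k => isClosed_singleton.preimage (continuous_coeffLin n s k)

theorem isClosed_modelSpace {n : ℕ} {Θ : Circ → Matrix (Fin n) (Fin n) ℂ} (hΘ : IsInner Θ) :
    IsClosed (modelSpace hΘ : Set (LpVec n 2)) := by
  rw [modelSpace, Submodule.coe_inf]
  refine IsClosed.inter ?_ (isClosed_hardy n 2)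
  have hi : Isometry (mulInner hΘ 2) :=
    AddMonoidHomClass.isometry_of_norm _ (norm_mulInner hΘ 2)
  exact hi.isClosedEmbedding.isClosedMap _ (isClosed_conjHardyZero n 2)

instance instCompleteModelSpace {n : ℕ} {Θ : Circ → Matrix (Fin n) (Fin n) ℂ}
    (hΘ : IsInner Θ) : CompleteSpace (modelSpace hΘ) :=
  (isClosed_modelSpace hΘ).completeSpace_coe

/-! ### Matrix-valued truncated Toeplitz operators -/

/-- `A = A_G^Θ`: the bounded operator `A` on `K_Θ` extends the map `f ↦ P_Θ (G f)`, which is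
defined for `f ∈ K_Θ ∩ (H^∞)ⁿ`; here `P_Θ` is the orthogonal projection of `(L²)ⁿ` onto `K_Θ`.
Such an `A` exists exactly when that map is bounded, and it is then unique, as
`K_Θ ∩ (H^∞)ⁿ` is dense in `K_Θ`. -/
def IsMTTO {n : ℕ} {Θ G : Circ → Matrix (Fin n) (Fin n) ℂ} (hΘ : IsInner Θ)
    (hG : MatrixMemLp G 2) (A : modelSpace hΘ →L[ℂ] modelSpace hΘ) : Prop :=
  ∀ (f : modelSpace hΘ) (hf : MemLp (f : LpVec n 2) ∞ mC),
    A f = (modelSpace hΘ).orthogonalProjectionOnto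
      ((hG.mulVecFun hf : MemLp (mulVecFun G (f : LpVec n 2)) 2 mC).toLp _)

/-! ### Uniqueness of Fourier coefficients -/

theorem ae_eq_zero_of_fourierCoeff {T : ℝ} [Fact (0 < T)] {n : ℕ}
    {f : AddCircle T → Cn n} (hf : Integrable f AddCircle.haarAddCircle)
    (h : ∀ k, fourierCoeff f k = 0) : f =ᵐ[AddCircle.haarAddCircle] 0 := by
  have hint : ∀ φ : C(AddCircle T, ℂ), Integrable (fun t => φ t • f t) AddCircle.haarAddCircle := by
    intro φ
    have := hf.bdd_smul (φ := ⇑φ) ‖φ‖ φ.continuous.aestronglyMeasurable <|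
      Filter.Eventually.of_forall fun t => φ.norm_coe_le_norm t
    exact this
  let L : C(AddCircle T, ℂ) →ₗ[ℂ] Cn n :=
    { toFun := fun φ => ∫ t, φ t • f t ∂AddCircle.haarAddCircle
      map_add' := fun φ ψ => by
        simp only [ContinuousMap.add_apply, add_smul]
        exact integral_add (hint φ) (hint ψ)
      map_smul' := fun z φ => by
        simp only [ContinuousMap.smul_apply, smul_assoc, RingHom.id_apply]
        exact integral_smul z _ }
  have hLc : Continuous L := by
    refine AddMonoidHomClass.continuous_of_bound L (∫ t, ‖f t‖ ∂AddCircle.haarAddCircle) fun φ => ?_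
    refine (norm_integral_le_integral_norm _).trans ?_
    rw [mul_comm (∫ t, ‖f t‖ ∂AddCircle.haarAddCircle) ‖φ‖, ← integral_const_mul]
    refine integral_mono (hint φ).norm (hf.norm.const_mul _) fun t => ?_
    simp only [norm_smul]
    exact mul_le_mul_of_nonneg_right (φ.norm_coe_le_norm t) (norm_nonneg _)
  have hL : ∀ φ, L φ = 0 := by
    have hle : (Submodule.span ℂ (Set.range (@fourier T))).topologicalClosure ≤
        LinearMap.ker L := by
      refine Submodule.topologicalClosure_minimal _ ?_
        (isClosed_singleton.preimage hLc)
      rw [Submodule.span_le]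
      rintro _ ⟨k, rfl⟩
      have := h (-k)
      rw [fourierCoeff, neg_neg] at this
      exact this
    rw [span_fourier_closure_eq_top] at hle
    exact fun φ => hle Submodule.mem_top
  refine ae_eq_zero_of_forall_setIntegral_isClosed_eq_zero hf fun s hs => ?_
  let δ : ℕ → ℝ := fun m => 1 / ((m : ℝ) + 1)
  have δ_pos : ∀ m, 0 < δ m := fun m => Nat.one_div_pos_of_nat
  have δ_lim : Filter.Tendsto δ Filter.atTop (nhds 0) := tendsto_one_div_add_atTop_nhds_zero_nat
  let φ : ℕ → C(AddCircle T, ℂ) := fun m =>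
    ⟨fun t => ((thickenedIndicator (δ_pos m) s t : ℝ) : ℂ),
      Complex.continuous_ofReal.comp
        (NNReal.continuous_coe.comp (thickenedIndicator (δ_pos m) s).continuous)⟩
  have hlim : Filter.Tendsto (fun m => ∫ t, φ m t • f t ∂AddCircle.haarAddCircle) Filter.atTop
      (nhds (∫ t, s.indicator f t ∂AddCircle.haarAddCircle)) := by
    refine tendsto_integral_of_dominated_convergence (fun t => ‖f t‖)
      (fun m => (hint (φ m)).aestronglyMeasurable) hf.norm (fun m => ?_) ?_
    · refine Filter.Eventually.of_forall fun t => ?_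
      rw [norm_smul]
      refine mul_le_of_le_one_left (norm_nonneg _) ?_
      have h1 : (thickenedIndicator (δ_pos m) s t : ℝ) ≤ 1 := by
        exact_mod_cast thickenedIndicator_le_one (δ_pos m) s t
      simpa [φ] using h1
    · refine Filter.Eventually.of_forall fun t => ?_
      have ht := (tendsto_pi_nhds.1
        (thickenedIndicator_tendsto_indicator_closure δ_pos δ_lim s)) t
      rw [hs.closure_eq] at ht
      have ht' : Filter.Tendsto (fun m => φ m t) Filter.atTop
          (nhds (((s.indicator (fun _ => (1 : NNReal)) t : NNReal) : ℝ) : ℂ)) :=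
        ((Complex.continuous_ofReal.comp NNReal.continuous_coe).tendsto _).comp ht
      have := ht'.smul_const (f t)
      by_cases hts : t ∈ s
      · simpa [hts] using this
      · simpa [hts] using this
  have h0 : ∀ m, ∫ t, φ m t • f t ∂AddCircle.haarAddCircle = 0 := fun m => hL (φ m)
  simp only [h0] at hlim
  rw [← integral_indicator hs.measurableSet]
  exact (tendsto_nhds_unique tendsto_const_nhds hlim).symm

theorem eq_zero_of_mem_hardy_of_mem_conjHardyZero {n : ℕ} {s : ℝ≥0∞} [Fact (1 ≤ s)]
    {f : LpVec n s} (h1 : f ∈ hardy n s) (h2 : f ∈ conjHardyZero n s) : f = 0 := by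
  rw [Lp.eq_zero_iff_ae_eq_zero]
  refine ae_eq_zero_of_fourierCoeff (integrable_LpVec f) fun k => ?_
  rcases lt_or_ge k 0 with hk | hk
  · exact mem_hardy.1 h1 k hk
  · exact mem_conjHardyZero.1 h2 k hk

theorem IsRieszProj.unique {n : ℕ} {s : ℝ≥0∞} [Fact (1 ≤ s)] {f g g' : LpVec n s}
    (h : IsRieszProj f g) (h' : IsRieszProj f g') : g = g' := by
  refine sub_eq_zero.1 (eq_zero_of_mem_hardy_of_mem_conjHardyZero
    (Submodule.sub_mem _ h.1 h'.1) ?_)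
  have := Submodule.sub_mem _ h'.2 h.2
  rwa [sub_sub_sub_cancel_left] at this

/-! ### The space Co-d -/

section CoDSection

variable {n : ℕ} {Θ G : Circ → Matrix (Fin n) (Fin n) ℂ} {p : ℝ≥0∞}
  (hΘ : IsInner Θ) (hG : MatrixMemLp G p)
  (q : ℝ≥0∞) [ENNReal.HolderTriple p 2 q] [Fact (1 ≤ q)]

/-- `(f, g) = (0, u) + (0, k) + (f, P_{q+} (G Θ f))` with `u ∈ Θ (H^q)ⁿ` and `k ∈ K_Θ`. -/
structure CoDRep (f : hardy n 2) (g : hardy n q) (u : LpVec n q) (k : LpVec n 2) : Prop where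
  left : u ∈ (hardy n q).map (mulInner hΘ q)
  mid : k ∈ modelSpace hΘ
  right : ∃ h : LpVec n q, IsRieszProj (mulLp hG 2 q (mulInner hΘ 2 f)) h ∧
    (g : LpVec n q) =ᵐ[mC] fun t => u t + k t + h t

variable {hΘ hG q}

theorem CoDRep.add {f f' : hardy n 2} {g g' : hardy n q} {u u' : LpVec n q} {k k' : LpVec n 2}
    (h : CoDRep hΘ hG q f g u k) (h' : CoDRep hΘ hG q f' g' u' k') :
    CoDRep hΘ hG q (f + f') (g + g') (u + u') (k + k') := by
  refine ⟨Submodule.add_mem _ h.left h'.left, Submodule.add_mem _ h.mid h'.mid, ?_⟩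
  obtain ⟨w, hw, e⟩ := h.right
  obtain ⟨w', hw', e'⟩ := h'.right
  refine ⟨w + w', ⟨Submodule.add_mem _ hw.1 hw'.1, ?_⟩, ?_⟩
  · have := Submodule.add_mem _ hw.2 hw'.2
    rw [Submodule.coe_add, map_add, map_add]
    convert this using 1
    abel
  · rw [Submodule.coe_add]
    filter_upwards [e, e', Lp.coeFn_add (g : LpVec n q) g', Lp.coeFn_add u u',
      Lp.coeFn_add k k', Lp.coeFn_add w w'] with t h1 h2 h3 h4 h5 h6
    simp only [h3, h4, h5, h6, Pi.add_apply, h1, h2]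
    abel

theorem CoDRep.smul {f : hardy n 2} {g : hardy n q} {u : LpVec n q} {k : LpVec n 2}
    (z : ℂ) (h : CoDRep hΘ hG q f g u k) :
    CoDRep hΘ hG q (z • f) (z • g) (z • u) (z • k) := by
  refine ⟨Submodule.smul_mem _ z h.left, Submodule.smul_mem _ z h.mid, ?_⟩
  obtain ⟨w, hw, e⟩ := h.right
  refine ⟨z • w, ⟨Submodule.smul_mem _ z hw.1, ?_⟩, ?_⟩
  · have := Submodule.smul_mem _ z hw.2
    rw [Submodule.coe_smul, map_smul, map_smul, ← smul_sub]
    exact this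
  · rw [Submodule.coe_smul]
    filter_upwards [e, Lp.coeFn_smul z (g : LpVec n q), Lp.coeFn_smul z u,
      Lp.coeFn_smul z k, Lp.coeFn_smul z w] with t h1 h3 h4 h5 h6
    simp only [h3, h4, h5, h6, Pi.smul_apply, h1, smul_add]

theorem CoDRep.zero : CoDRep hΘ hG q 0 0 0 0 := by
  refine ⟨Submodule.zero_mem _, Submodule.zero_mem _, 0, ⟨Submodule.zero_mem _, ?_⟩, ?_⟩
  · simp
  · filter_upwards [Lp.coeFn_zero (Cn n) q mC, Lp.coeFn_zero (Cn n) 2 mC] with t h1 h2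
    simp

theorem CoDRep.eq_zero {g : hardy n q} {u : LpVec n q} {k : LpVec n 2}
    (h : CoDRep hΘ hG q 0 g u k) (hg : g = 0) : u = 0 ∧ k = 0 := by
  obtain ⟨⟨v, hv, rfl⟩, ⟨⟨m, hm, rfl⟩, -⟩, w, hw, e⟩ := h
  have hw0 : w = 0 := by
    refine hw.unique ⟨Submodule.zero_mem _, ?_⟩
    simp
  subst hw0 hg
  -- `Θ v + Θ m = 0`, hence `v = -m`; one is analytic, the other co-analytic
  have hvm : ∀ᵐ t ∂mC, v t + m t = 0 := by
    filter_upwards [e, Lp.coeFn_zero (Cn n) q mC, coeFn_mulLp hΘ.memLp q q v,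
      coeFn_mulLp hΘ.memLp 2 2 m, hΘ.unitary] with t h1 h2 h3 h4 hu
    rw [Submodule.coe_zero, h2] at h1
    have h5 : mulVecFun Θ v t + mulVecFun Θ m t = 0 := by
      rw [← h3, ← h4]
      simpa [mulInner] using h1.symm
    rw [← norm_eq_zero, ← norm_mulVecFun_of_unitary hu, norm_eq_zero]
    rw [← h5]
    simp [mulVecFun, Matrix.mulVec_add]
  have hv0 : v = 0 := by
    refine eq_zero_of_mem_hardy_of_mem_conjHardyZero hv (mem_conjHardyZero.2 fun k hk => ?_)
    have hvm' : (v : Circ → Cn n) =ᵐ[mC] ((-m : LpVec n 2) : Circ → Cn n) := by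
      filter_upwards [hvm, Lp.coeFn_neg m] with t h1 h2
      rw [h2, Pi.neg_apply, eq_neg_iff_add_eq_zero, h1]
    rw [fourierCoeff_congr_ae hvm']
    exact mem_conjHardyZero.1 (Submodule.neg_mem _ hm) k hk
  have hm0 : m = 0 := by
    rw [Lp.eq_zero_iff_ae_eq_zero]
    rw [Lp.eq_zero_iff_ae_eq_zero] at hv0
    filter_upwards [hvm, hv0] with t h1 h2
    simpa [h2] using h1
  rw [hv0, hm0, map_zero, map_zero]
  exact ⟨rfl, rfl⟩

theorem CoDRep.unique {f : hardy n 2} {g : hardy n q} {u u' : LpVec n q} {k k' : LpVec n 2}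
    (h : CoDRep hΘ hG q f g u k) (h' : CoDRep hΘ hG q f g u' k') : u = u' ∧ k = k' := by
  have h0 := h.add (h'.smul (-1))
  have hf : f + (-1 : ℂ) • f = 0 := by simp
  rw [hf] at h0
  have := h0.eq_zero (by simp)
  simpa [← sub_eq_add_neg, sub_eq_zero] using this

variable (hΘ hG q)

/-- Co-d as a linear subspace of `(H²)ⁿ × (H^q)ⁿ`. -/
def coDSubmodule : Submodule ℂ (hardy n 2 × hardy n q) where
  carrier := {x | ∃ u k, CoDRep hΘ hG q x.1 x.2 u k}
  add_mem' := fun ⟨u, k, h⟩ ⟨u', k', h'⟩ => ⟨u + u', k + k', h.add h'⟩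
  zero_mem' := ⟨0, 0, CoDRep.zero⟩
  smul_mem' := fun z _ ⟨u, k, h⟩ => ⟨z • u, z • k, h.smul z⟩

/-- The space Co-d. It has its own norm, not that of the ambient product. -/
def CoD : Type := coDSubmodule hΘ hG q

instance instAddCommGroupCoD : AddCommGroup (CoD hΘ hG q) :=
  inferInstanceAs (AddCommGroup (coDSubmodule hΘ hG q))

instance instModuleCoD : Module ℂ (CoD hΘ hG q) :=
  inferInstanceAs (Module ℂ (coDSubmodule hΘ hG q))

variable {hΘ hG q}

/-- The first `n` coordinates of an element of Co-d. -/
def CoD.fst (x : CoD hΘ hG q) : hardy n 2 := x.1.1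

/-- The last `n` coordinates of an element of Co-d. -/
def CoD.snd (x : CoD hΘ hG q) : hardy n q := x.1.2

/-- The summand `Θ p₁` of an element of Co-d. -/
def CoD.inner (x : CoD hΘ hG q) : LpVec n q := x.2.choose

/-- The summand `p₂ ∈ K_Θ` of an element of Co-d. -/
def CoD.model (x : CoD hΘ hG q) : LpVec n 2 := x.2.choose_spec.choose

theorem CoD.rep (x : CoD hΘ hG q) : CoDRep hΘ hG q x.fst x.snd x.inner x.model :=
  x.2.choose_spec.choose_spec

theorem CoD.inner_model_eq {x : CoD hΘ hG q} {u : LpVec n q} {k : LpVec n 2}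
    (h : CoDRep hΘ hG q x.fst x.snd u k) : x.inner = u ∧ x.model = k :=
  x.rep.unique h

variable (hΘ hG q)

/-- The norm of Co-d: `‖(0, Θ p₁) + (0, p₂) + (p₃, P_{q+} (G Θ p₃))‖ = ‖Θ p₁‖ + ‖p₂‖ + ‖p₃‖`. -/
def coDNorm : AddGroupNorm (CoD hΘ hG q) where
  toFun x := ‖x.inner‖ + ‖x.model‖ + ‖x.fst‖
  map_zero' := by
    obtain ⟨h1, h2⟩ := CoD.inner_model_eq (x := (0 : CoD hΘ hG q)) CoDRep.zero
    have h3 : (0 : CoD hΘ hG q).fst = 0 := rfl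
    rw [h1, h2, h3]
    simp
  add_le' x y := by
    obtain ⟨h1, h2⟩ := CoD.inner_model_eq (x := x + y) (x.rep.add y.rep)
    have h3 : (x + y).fst = x.fst + y.fst := rfl
    rw [h1, h2, h3]
    have e1 := norm_add_le x.inner y.inner
    have e2 := norm_add_le x.model y.model
    have e3 := norm_add_le x.fst y.fst
    linarith
  neg' x := by
    have h := x.rep.smul (-1)
    simp only [neg_smul, one_smul] at h
    obtain ⟨h1, h2⟩ := CoD.inner_model_eq (x := -x) h
    have h3 : (-x).fst = -x.fst := rfl
    rw [h1, h2, h3, norm_neg, norm_neg, norm_neg]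
  eq_zero_of_map_eq_zero' x hx := by
    have e1 := norm_nonneg x.inner
    have e2 := norm_nonneg x.model
    have e3 := norm_nonneg x.fst
    have h1 : x.inner = 0 := norm_eq_zero.1 (by linarith)
    have h2 : x.model = 0 := norm_eq_zero.1 (by linarith)
    have h3 : x.fst = 0 := norm_eq_zero.1 (by linarith)
    have hr := x.rep
    obtain ⟨w, hw, e⟩ := hr.right
    rw [h3] at hw
    have hw0 : w = 0 := by
      refine hw.unique ⟨Submodule.zero_mem _, ?_⟩
      simp
    have h4 : x.snd = 0 := by
      rw [h1, h2, hw0] at e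
      apply Subtype.ext
      rw [Submodule.coe_zero, Lp.eq_zero_iff_ae_eq_zero]
      filter_upwards [e, Lp.coeFn_zero (Cn n) q mC] with t a b
      simp [a, b]
    exact Subtype.ext (Prod.ext h3 h4)

instance instNormedAddCommGroupCoD : NormedAddCommGroup (CoD hΘ hG q) :=
  { (coDNorm hΘ hG q).toNormedAddCommGroup, instAddCommGroupCoD hΘ hG q with }

variable {hΘ hG q}

theorem CoD.norm_eq {x : CoD hΘ hG q} {u : LpVec n q} {k : LpVec n 2}
    (h : CoDRep hΘ hG q x.fst x.snd u k) : ‖x‖ = ‖u‖ + ‖k‖ + ‖x.fst‖ := by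
  obtain ⟨h1, h2⟩ := CoD.inner_model_eq h
  rw [← h1, ← h2]
  rfl

variable (hΘ hG q)

instance instNormedSpaceCoD : NormedSpace ℂ (CoD hΘ hG q) where
  norm_smul_le z x := by
    have h3 : (z • x).fst = z • x.fst := rfl
    rw [CoD.norm_eq (x := z • x) (x.rep.smul z), CoD.norm_eq x.rep, h3, norm_smul, norm_smul,
      norm_smul, mul_add, mul_add]

/-! ### The Toeplitz operator with restricted codomain -/

/-- The Banach space direct sum, with norm `‖x‖ + ‖y‖`. -/
abbrev Sum1 (X Y : Type) : Type := WithLp 1 (X × Y)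

/-- `T = T_𝒢^r` for the block symbol `𝒢` with rows `(Θ^*, 0)` and `(G, Θ)`: the bounded operator
from `(H²)ⁿ ⊕ (H^q)ⁿ` to Co-d that maps `(f₁, f₂)` to
`(P_{2+} (Θ^* f₁), P_{q+} (G f₁ + Θ f₂))`. -/
def IsRestrictedToeplitz (T : Sum1 (hardy n 2) (hardy n q) →L[ℂ] CoD hΘ hG q) : Prop :=
  ∀ (f₁ : hardy n 2) (f₂ : hardy n q),
    IsRieszProj (mulInnerAdj hΘ 2 (f₁ : LpVec n 2)) (T (WithLp.toLp 1 (f₁, f₂))).fst ∧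
    IsRieszProj (mulLp hG 2 q (f₁ : LpVec n 2) + mulInner hΘ q (f₂ : LpVec n q))
      (T (WithLp.toLp 1 (f₁, f₂))).snd

end CoDSection

/-- Equivalence after extension of `T : X → X'` and `S : Y → Y'`: there are Banach spaces
`X₀`, `Y₀` and invertible bounded operators `E`, `F` (with bounded inverses) such that
`T ⊕ I_{X₀} = E (S ⊕ I_{Y₀}) F`. -/
def EquivAfterExt {X X' Y Y' : Type}
    [NormedAddCommGroup X] [NormedSpace ℂ X] [NormedAddCommGroup X'] [NormedSpace ℂ X']
    [NormedAddCommGroup Y] [NormedSpace ℂ Y] [NormedAddCommGroup Y'] [NormedSpace ℂ Y']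
    (T : X →L[ℂ] X') (S : Y →L[ℂ] Y') : Prop :=
  ∃ (X₀ Y₀ : Type) (_ : NormedAddCommGroup X₀) (_ : NormedSpace ℂ X₀) (_ : CompleteSpace X₀)
    (_ : NormedAddCommGroup Y₀) (_ : NormedSpace ℂ Y₀) (_ : CompleteSpace Y₀)
    (E : Sum1 Y' Y₀ ≃L[ℂ] Sum1 X' X₀) (F : Sum1 X X₀ ≃L[ℂ] Sum1 Y Y₀),
    ∀ (x : X) (x₀ : X₀),
      (WithLp.toLp 1 (T x, x₀) : Sum1 X' X₀) =
        E (WithLp.toLp 1 (S (F (WithLp.toLp 1 (x, x₀))).fst, (F (WithLp.toLp 1 (x, x₀))).snd))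

end MTTO

end

noncomputable section

namespace MTTO

/-! In suitable coordinates on both sides, the Toeplitz operator is literally `A ⊕ I`. On the
domain, `(H²)ⁿ = K_Θ ⊕ Θ(H²)ⁿ`: every `f₁` is `k + Θh` with `k = P_Θ f₁` and `h = P_{2+}(Θ^* f₁)`.
On the codomain, the triple `(p₂, p₁, p₃)` is a coordinate system. Since `Θ` acts isometrically, the
norm of Co-d is the sum of the norms of the three coordinates, so Co-d is isomorphic to `K_Θ ×
(H^q)ⁿ × (H²)ⁿ` and complete.

The link is the identity `P_{q+}(Gk) = Ak + Θ P_{q+}(Θ^* G k)` for `k ∈ K_Θ`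
(`riesz_mulLp_modelSpace`). With it, `(k + Θh, f₂)` is sent to the element of Co-d with `p₂ = Ak`,
`p₁ = f₂ + P_{q+}(Θ^* G k)`, `p₃ = h`. Taking `a = f₂ + P_{q+}(Θ^* G k)` in place of `f₂`, which is
an invertible triangular change of variables (`domEquiv`), turns the operator into `(k, a, h) ↦ (Ak,
a, h)`. Hence `X₀ = (H^q)ⁿ × (H²)ⁿ` and a trivial `Y₀` suffice.

For bounded `k` the identity is the formula `P_Θ = P_{2+} - Θ P_{2+} Θ^*` applied to `Gk ∈ (L²)ⁿ`.
It passes to all of `K_Θ` because bounded functions are dense there (`dense_boundedModel`) and both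
sides are continuous from `K_Θ` to `(L^q)ⁿ`. Continuity rests on Hölder's inequality and on the
boundedness of `P_{q+}`.

That boundedness, for `1 < q ≤ 2`, is the theorem of M. Riesz. On the right half-plane `|w|^s ≤ A
(Re w)^s - B Re(w^s)`. Integrating this along an analytic polynomial `F` of positive real part with
`F(0)` real, the last term has mean `-B F(0)^s ≤ 0`, so `F` is controlled by its real part.
Splitting a real part into positive and negative parts removes the sign condition, and density gives
the projection on all of `L^s`. -/

/-! ### The theorem of M. Riesz for `1 < s ≤ 2` -/

/-- The elementary inequality behind the theorem of M. Riesz. -/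
theorem exists_rpow_norm_le_sub_re_cpow {s : ℝ} (hs1 : 1 < s) (hs2 : s ≤ 2) :
    ∃ A B : ℝ, 0 ≤ A ∧ 0 ≤ B ∧ ∀ w : ℂ, 0 < w.re →
      ‖w‖ ^ s ≤ A * w.re ^ s - B * (w ^ (s : ℂ)).re := by
  have hpi := Real.pi_pos
  -- The angle `a` is chosen so that `cos a > 0` while `cos (s a) < 0`; this is possible exactly
  -- because `s > 1`.
  obtain ⟨a, ha1, ha2⟩ : ∃ a, Real.pi / (2 * s) < a ∧ a < Real.pi / 2 :=
    exists_between (div_lt_div_of_pos_left hpi (by norm_num) (by linarith))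
  have ha0 : 0 < a := lt_trans (by positivity) ha1
  have hsa : Real.pi / 2 < s * a := by
    rw [div_lt_iff₀ (by positivity)] at ha1
    linarith
  have hsa' : s * a ≤ Real.pi := by nlinarith
  have hc : Real.cos (s * a) < 0 :=
    Real.cos_neg_of_pi_div_two_lt_of_lt hsa (by linarith)
  have hca : 0 < Real.cos a := Real.cos_pos_of_mem_Ioo ⟨by linarith, ha2⟩
  set B : ℝ := (-Real.cos (s * a))⁻¹ with hB
  have hB0 : 0 < B := inv_pos.2 (by linarith)
  have hA0 : 0 < (1 + B) / Real.cos a ^ s := by positivity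
  refine ⟨(1 + B) / Real.cos a ^ s, B, hA0.le, hB0.le, fun w hw => ?_⟩
  have hw0 : w ≠ 0 := fun h => by simp [h] at hw
  have hr : 0 < ‖w‖ := norm_pos_iff.2 hw0
  have hre : w.re = ‖w‖ * Real.cos w.arg := by
    rw [Complex.norm_mul_cos_arg]
  have hpow : (w ^ (s : ℂ)).re = ‖w‖ ^ s * Real.cos (s * w.arg) := by
    rw [Complex.cpow_ofReal_re, mul_comm s]
  have harg : |w.arg| < Real.pi / 2 := Complex.abs_arg_lt_pi_div_two_iff.2 (Or.inl hw)
  have hcos : 0 < Real.cos w.arg := by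
    rw [hre] at hw
    exact (pos_iff_pos_of_mul_pos hw).1 hr
  rw [hpow, hre, Real.mul_rpow hr.le hcos.le]
  -- Two sectors. Near the imaginary axis, `|arg w| ≥ a`, the term `-B cos (s arg w)` is already at
  -- least `1`; here `s ≤ 2` keeps `s |arg w|` in `[0, π]`, where cosine decreases. For `|arg w| ≤
  -- a` the first term is at least `1 + B`, which absorbs the at most `B` that is subtracted.
  have key : 1 ≤ (1 + B) / Real.cos a ^ s * Real.cos w.arg ^ s - B * Real.cos (s * w.arg) := by
    rw [← Real.cos_abs w.arg, ← Real.cos_abs (s * w.arg), abs_mul, abs_of_pos (by linarith : 0 < s)]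
    rw [← Real.cos_abs w.arg] at hcos
    rcases le_total a |w.arg| with h | h
    · have h1 : Real.cos (s * |w.arg|) ≤ Real.cos (s * a) :=
        Real.cos_le_cos_of_nonneg_of_le_pi (by positivity) (by nlinarith) (by gcongr)
      have h2 : B * -Real.cos (s * a) = 1 := inv_mul_cancel₀ (by linarith)
      have h3 : 0 ≤ (1 + B) / Real.cos a ^ s * Real.cos |w.arg| ^ s := by positivity
      nlinarith
    · have h1 : Real.cos a ≤ Real.cos |w.arg| :=
        Real.cos_le_cos_of_nonneg_of_le_pi (abs_nonneg _) (by linarith) h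
      have h2 : Real.cos a ^ s ≤ Real.cos |w.arg| ^ s :=
        Real.rpow_le_rpow hca.le h1 (by linarith)
      have h3 : 1 + B ≤ (1 + B) / Real.cos a ^ s * Real.cos |w.arg| ^ s := by
        rw [div_mul_eq_mul_div, le_div_iff₀ (by positivity)]
        gcongr
      have h4 := Real.cos_le_one (s * |w.arg|)
      nlinarith
  have h5 : 0 < ‖w‖ ^ s := by positivity
  nlinarith

/-! ### Mean values and analytic polynomials on the circle -/

theorem fourier_one_coe (x : ℝ) : fourier 1 (x : Circ) = circleMap 0 1 x := by
  rw [fourier_coe_apply, circleMap_zero, Complex.ofReal_one, one_mul]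
  congr 1
  have : (Real.pi : ℂ) ≠ 0 := by exact_mod_cast Real.pi_ne_zero
  push_cast
  field_simp

/-- The mean value property on the unit circle. -/
theorem integral_comp_fourier_one {φ : ℂ → ℂ} (hφ : DiffContOnCl ℂ φ (Metric.ball 0 1)) :
    ∫ t : Circ, φ (fourier 1 t) ∂mC = φ 0 := by
  have h := DiffContOnCl.circleAverage (R := 1) (c := 0) (f := φ) (by simpa using hφ)
  rw [← h, Real.circleAverage, AddCircle.integral_haarAddCircle,
    ← AddCircle.intervalIntegral_preimage (2 * Real.pi) 0, zero_add]
  simp only [fourier_one_coe]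

/-- The trace on the unit circle of a polynomial. -/
def trace (F : Polynomial ℂ) : C(Circ, ℂ) :=
  ⟨fun t => F.eval (fourier 1 t), F.continuous.comp (map_continuous _)⟩

theorem trace_apply (F : Polynomial ℂ) (t : Circ) : trace F t = F.eval (fourier 1 t) := rfl

theorem exists_fourier_one_eq {z : ℂ} (hz : ‖z‖ = 1) : ∃ t : Circ, fourier 1 t = z := by
  refine ⟨((z.arg : ℝ) : Circ), ?_⟩
  rw [fourier_one_coe, circleMap_zero]
  have := Complex.norm_mul_exp_arg_mul_I z
  rwa [hz] at this

/-- Maximum principle for `exp (-F)`, whose modulus is `exp (-Re F)`. Compactness of the circle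
provides a positive minimum of `Re F` there, so positivity stays strict inside the disc. -/
theorem re_eval_pos {F : Polynomial ℂ} (h : ∀ t, 0 < (trace F t).re) {z : ℂ}
    (hz : z ∈ Metric.closedBall (0 : ℂ) 1) : 0 < (F.eval z).re := by
  obtain ⟨t₀, -, ht₀⟩ := (isCompact_univ (X := Circ)).exists_isMinOn Set.univ_nonempty
    (Complex.continuous_re.comp (map_continuous (trace F))).continuousOn
  have hmin : ∀ t, (trace F t₀).re ≤ (trace F t).re := fun t => ht₀ (Set.mem_univ t)
  have hd : Differentiable ℂ fun z => Complex.exp (-F.eval z) :=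
    F.differentiable.neg.cexp
  have := Complex.norm_le_of_forall_mem_frontier_norm_le (U := Metric.ball (0 : ℂ) 1)
    (f := fun z => Complex.exp (-F.eval z)) Metric.isBounded_ball hd.diffContOnCl
    (C := Real.exp (-(trace F t₀).re)) (fun w hw => ?_)
    (z := z) (by rwa [closure_ball _ one_ne_zero])
  · rw [Complex.norm_exp, Real.exp_le_exp, Complex.neg_re] at this
    linarith [h t₀]
  · rw [frontier_ball _ one_ne_zero, mem_sphere_zero_iff_norm] at hw
    obtain ⟨t, rfl⟩ := exists_fourier_one_eq hw
    rw [Complex.norm_exp, Real.exp_le_exp, Complex.neg_re]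
    exact neg_le_neg (hmin t)

theorem integrable_of_continuous {E : Type*} [NormedAddCommGroup E] {f : Circ → E}
    (hf : Continuous f) : Integrable f mC :=
  hf.integrable_of_hasCompactSupport (HasCompactSupport.of_compactSpace f)

theorem memLp_of_continuous {f : Circ → ℂ} (hf : Continuous f) (s : ℝ≥0∞) : MemLp f s mC := by
  obtain ⟨C, hC⟩ := (isCompact_range hf).isBounded.exists_norm_le
  exact MemLp.of_bound hf.aestronglyMeasurable C
    (Filter.Eventually.of_forall fun t => hC _ ⟨t, rfl⟩)

/-- Analytic polynomials of positive real part. -/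
theorem integral_rpow_norm_trace_le {s A B : ℝ} (hs : 0 < s) (hB : 0 ≤ B)
    (hAB : ∀ w : ℂ, 0 < w.re → ‖w‖ ^ s ≤ A * w.re ^ s - B * (w ^ (s : ℂ)).re)
    {F : Polynomial ℂ} (h : ∀ t, 0 < (trace F t).re) (h0 : (F.eval 0).im = 0) :
    ∫ t, ‖trace F t‖ ^ s ∂mC ≤ A * ∫ t, (trace F t).re ^ s ∂mC := by
  have hre : Continuous fun t => (trace F t).re :=
    Complex.continuous_re.comp (map_continuous (trace F))
  have hc : Continuous fun t => (trace F t) ^ (s : ℂ) :=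
    (map_continuous (trace F)).cpow continuous_const fun t => Or.inl (h t)
  have hi1 : Integrable (fun t => (trace F t).re ^ s) mC :=
    integrable_of_continuous (hre.rpow_const fun t => Or.inr hs.le)
  have hi2 : Integrable (fun t => ((trace F t) ^ (s : ℂ)).re) mC :=
    integrable_of_continuous (Complex.continuous_re.comp hc)
  -- `F` maps the closed disc into the right half-plane, where the principal power is holomorphic,
  -- so `F^s` has the mean value property. Its mean `F(0)^s` is positive because `F(0)` is a
  -- positive real, and the term with `B` can be dropped.
  have hmv : ∫ t, (trace F t) ^ (s : ℂ) ∂mC = (F.eval 0) ^ (s : ℂ) := by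
    refine integral_comp_fourier_one (φ := fun z => (F.eval z) ^ (s : ℂ)) ⟨?_, ?_⟩
    · intro z hz
      exact (F.differentiable z).differentiableWithinAt.cpow (differentiableWithinAt_const _)
        (Or.inl (re_eval_pos h (Metric.ball_subset_closedBall hz)))
    · rw [closure_ball _ one_ne_zero]
      exact F.continuous.continuousOn.cpow continuousOn_const fun z hz =>
        Or.inl (re_eval_pos h hz)
  have hmv' : 0 ≤ ∫ t, ((trace F t) ^ (s : ℂ)).re ∂mC := by
    have := integral_re (𝕜 := ℂ) (integrable_of_continuous hc)
    simp only [RCLike.re_to_complex] at this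
    rw [this, hmv]
    have hp := re_eval_pos h (Metric.mem_closedBall_self zero_le_one)
    have e : F.eval 0 = ((F.eval 0).re : ℂ) := Complex.ext rfl (by simp [h0])
    rw [e, ← Complex.ofReal_cpow hp.le, Complex.ofReal_re]
    positivity
  calc ∫ t, ‖trace F t‖ ^ s ∂mC
      ≤ ∫ t, (A * (trace F t).re ^ s - B * ((trace F t) ^ (s : ℂ)).re) ∂mC :=
        integral_mono (integrable_of_continuous
          ((map_continuous (trace F)).norm.rpow_const fun t => Or.inr hs.le))
          ((hi1.const_mul A).sub (hi2.const_mul B)) fun t => hAB _ (h t)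
    _ = A * ∫ t, (trace F t).re ^ s ∂mC - B * ∫ t, ((trace F t) ^ (s : ℂ)).re ∂mC := by
        rw [integral_sub (hi1.const_mul A) (hi2.const_mul B), integral_const_mul,
          integral_const_mul]
    _ ≤ _ := by nlinarith

/-- The case of exponent two needs no positivity. -/
theorem integral_sq_norm_trace_le {F : Polynomial ℂ} (h0 : (F.eval 0).im = 0) :
    ∫ t, ‖trace F t‖ ^ (2 : ℝ) ∂mC ≤ 2 * ∫ t, |(trace F t).re| ^ (2 : ℝ) ∂mC := by
  have hF := map_continuous (trace F)
  have hc : Continuous fun t => (trace F t) ^ 2 := hF.pow 2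
  have hmv : ∫ t, (trace F t) ^ 2 ∂mC = (F.eval 0) ^ 2 :=
    integral_comp_fourier_one (φ := fun z => (F.eval z) ^ 2) (F.differentiable.pow 2).diffContOnCl
  have hmv' : 0 ≤ ∫ t, ((trace F t) ^ 2).re ∂mC := by
    have := integral_re (𝕜 := ℂ) (integrable_of_continuous hc)
    simp only [RCLike.re_to_complex] at this
    rw [this, hmv, sq, Complex.mul_re, h0]
    nlinarith [sq_nonneg (F.eval 0).re]
  have hi1 : Integrable (fun t => |(trace F t).re| ^ (2 : ℝ)) mC := integrable_of_continuous
    ((Complex.continuous_re.comp hF).abs.rpow_const fun t => Or.inr (by norm_num))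
  have hi2 : Integrable (fun t => ((trace F t) ^ 2).re) mC :=
    integrable_of_continuous (Complex.continuous_re.comp hc)
  -- The elementary inequality becomes an equality for `s = 2`, with `A = 2` and `B = 1`, and holds
  -- on the whole plane.
  have e : ∀ t, ‖trace F t‖ ^ (2 : ℝ) =
      2 * |(trace F t).re| ^ (2 : ℝ) - ((trace F t) ^ 2).re := by
    intro t
    rw [Real.rpow_two, Real.rpow_two, Complex.sq_norm, Complex.normSq_apply, sq_abs,
      sq (trace F t), Complex.mul_re]
    ring
  simp only [e]
  rw [integral_sub (hi1.const_mul 2) hi2, integral_const_mul]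
  linarith

theorem eLpNorm_le_of_integral_rpow_le {f g : Circ → ℝ} (hf : Continuous f) (hg : Continuous g)
    {s : ℝ≥0∞} (hs0 : s ≠ 0) (hs : s ≠ ∞) {A : ℝ} (hA : 0 ≤ A)
    (h : ∫ t, ‖f t‖ ^ s.toReal ∂mC ≤ A * ∫ t, ‖g t‖ ^ s.toReal ∂mC) :
    eLpNorm f s mC ≤ ENNReal.ofReal (A ^ s.toReal⁻¹) * eLpNorm g s mC := by
  have hm : ∀ {f : Circ → ℝ}, Continuous f → MemLp f s mC := fun {f} hf =>
    (memLp_of_continuous (Complex.continuous_ofReal.comp hf) s).re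
  rw [(hm hf).eLpNorm_eq_integral_rpow_norm hs0 hs, (hm hg).eLpNorm_eq_integral_rpow_norm hs0 hs,
    ← ENNReal.ofReal_mul (by positivity), ← Real.mul_rpow hA (by positivity)]
  gcongr

theorem continuous_re_trace (F : Polynomial ℂ) : Continuous fun t => (trace F t).re :=
  Complex.continuous_re.comp (map_continuous (trace F))

theorem eLpNorm_two_trace_le {F : Polynomial ℂ} (h0 : (F.eval 0).im = 0) :
    eLpNorm (trace F) 2 mC ≤ 2 * eLpNorm (fun t => (trace F t).re) 2 mC := by
  -- The constant `2` is available; it is weakened to `4` so that its square root is the integer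
  -- `2`.
  have := eLpNorm_le_of_integral_rpow_le (f := fun t => ‖trace F t‖)
    (g := fun t => (trace F t).re) (map_continuous (trace F)).norm (continuous_re_trace F)
    (s := 2) (by simp) (by simp) (A := 4) (by norm_num) (by
      have := integral_sq_norm_trace_le h0
      have h2 : 0 ≤ ∫ t, |(trace F t).re| ^ (2 : ℝ) ∂mC := integral_nonneg fun t => by positivity
      simp only [abs_norm, ENNReal.toReal_ofNat, Real.norm_eq_abs]
      linarith)
  rw [eLpNorm_norm] at this
  refine this.trans_eq ?_
  congr 1
  rw [show (4 : ℝ) = 2 ^ (2 : ℝ) by norm_num, ENNReal.toReal_ofNat,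
    Real.rpow_rpow_inv (by norm_num) (by norm_num)]
  simp

theorem exists_eLpNorm_trace_le_of_pos {s : ℝ≥0∞} (hs1 : 1 < s) (hs2 : s ≤ 2) :
    ∃ C : ℝ≥0∞, C ≠ ∞ ∧ ∀ F : Polynomial ℂ, (∀ t, 0 < (trace F t).re) → (F.eval 0).im = 0 →
      eLpNorm (trace F) s mC ≤ C * eLpNorm (fun t => (trace F t).re) s mC := by
  have hs : s ≠ ∞ := ne_top_of_le_ne_top (by simp) hs2
  have h1 : 1 < s.toReal := by
    simpa using (ENNReal.toReal_lt_toReal (by simp) hs).2 hs1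
  have h2 : s.toReal ≤ 2 := by
    simpa using (ENNReal.toReal_le_toReal hs (by simp)).2 hs2
  obtain ⟨A, B, hA, hB, hAB⟩ := exists_rpow_norm_le_sub_re_cpow h1 h2
  refine ⟨ENNReal.ofReal (A ^ s.toReal⁻¹), by simp, fun F hF h0 => ?_⟩
  have := eLpNorm_le_of_integral_rpow_le (f := fun t => ‖trace F t‖)
    (g := fun t => (trace F t).re) (map_continuous (trace F)).norm (continuous_re_trace F)
    (s := s) (by rintro rfl; simp at hs1) hs hA (by
      have := integral_rpow_norm_trace_le (by linarith) hB hAB hF h0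
      have e : ∀ t, ‖(trace F t).re‖ = (trace F t).re := fun t => Real.norm_of_nonneg (hF t).le
      simpa only [norm_norm, e] using this)
  rwa [eLpNorm_norm] at this

/-! ### Approximation and removal of the positivity condition -/

/-- The real part of a trigonometric polynomial is that of an analytic polynomial. -/
theorem exists_re_trace_eq {p : C(Circ, ℂ)} (hp : p ∈ Submodule.span ℂ (Set.range (@fourier _))) :
    ∃ F : Polynomial ℂ, (F.eval 0).im = 0 ∧ ∀ t, (trace F t).re = (p t).re := by
  have h : ∃ F F' : Polynomial ℂ, ∀ t, p t = trace F t + star (trace F' t) := by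
    induction hp using Submodule.span_induction with
    | mem p hp =>
      obtain ⟨k, rfl⟩ := hp
      have hk : ∀ (m : ℕ) (t : Circ), fourier (m : ℤ) t = trace (Polynomial.X ^ m) t := by
        intro m t
        simp [trace_apply, fourier_apply, AddCircle.toCircle_nsmul]
      obtain ⟨m, rfl | rfl⟩ := k.eq_nat_or_neg
      · exact ⟨Polynomial.X ^ m, 0, fun t => by rw [hk]; simp [trace_apply]⟩
      · exact ⟨0, Polynomial.X ^ m, fun t => by rw [fourier_neg, hk]; simp [trace_apply]⟩
    | zero => exact ⟨0, 0, fun t => by simp [trace_apply]⟩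
    | add p p' _ _ h h' =>
      obtain ⟨F, G, h⟩ := h
      obtain ⟨F', G', h'⟩ := h'
      refine ⟨F + F', G + G', fun t => ?_⟩
      simp only [ContinuousMap.add_apply, h, h', trace_apply, Polynomial.eval_add, star_add]
      ring
    | smul z p _ h =>
      obtain ⟨F, G, h⟩ := h
      refine ⟨Polynomial.C z * F, Polynomial.C (star z) * G, fun t => ?_⟩
      simp only [ContinuousMap.smul_apply, h, trace_apply, Polynomial.eval_mul, Polynomial.eval_C,
        star_mul', star_star, smul_eq_mul]
      ring
  obtain ⟨F, G, h⟩ := h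
  -- Conjugating the second summand leaves its real part unchanged, and subtracting an imaginary
  -- constant makes the value at `0` real without affecting the real part.
  refine ⟨F + G - Polynomial.C (((F + G).eval 0).im * Complex.I), by simp, fun t => ?_⟩
  rw [h]
  simp [trace_apply]

theorem exists_abs_re_trace_sub_lt (f : C(Circ, ℝ)) {δ : ℝ} (hδ : 0 < δ) :
    ∃ F : Polynomial ℂ, (F.eval 0).im = 0 ∧ ∀ t, |(trace F t).re - f t| < δ := by
  let f' : C(Circ, ℂ) := ⟨fun t => (f t : ℂ), Complex.continuous_ofReal.comp (map_continuous f)⟩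
  have hf' : f' ∈ closure (Submodule.span ℂ (Set.range (@fourier (2 * Real.pi))) : Set C(Circ, ℂ)) := by
    rw [← Submodule.topologicalClosure_coe, span_fourier_closure_eq_top]
    trivial
  obtain ⟨p, hp, hd⟩ := Metric.mem_closure_iff.1 hf' δ hδ
  obtain ⟨F, h0, hF⟩ := exists_re_trace_eq hp
  refine ⟨F, h0, fun t => ?_⟩
  have e : (trace F t).re - f t = (p t - f' t).re := by simp [hF, f']
  rw [e]
  refine (Complex.abs_re_le_norm _).trans_lt ?_
  rw [← dist_eq_norm, dist_comm]
  exact (ContinuousMap.dist_apply_le_dist t).trans_lt hd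

theorem eLpNorm_le_ofReal_of_abs_le {f : Circ → ℝ} {δ : ℝ} (h : ∀ t, |f t| ≤ δ) (s : ℝ≥0∞) :
    eLpNorm f s mC ≤ ENNReal.ofReal δ := by
  have := eLpNorm_le_of_ae_bound (p := s) (μ := mC) (f := f) (C := δ)
    (Filter.Eventually.of_forall h)
  simpa using this

theorem trace_sub (F G : Polynomial ℂ) : trace (F - G) = trace F - trace G := by
  ext t; simp [trace_apply]

/-- The theorem of M. Riesz for analytic polynomials. -/
theorem exists_eLpNorm_trace_le {s : ℝ≥0∞} (hs1 : 1 < s) (hs2 : s ≤ 2) :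
    ∃ C : ℝ≥0∞, C ≠ ∞ ∧ ∀ F : Polynomial ℂ, (F.eval 0).im = 0 →
      eLpNorm (trace F) s mC ≤ C * eLpNorm (fun t => (trace F t).re) s mC := by
  obtain ⟨C, hC, h⟩ := exists_eLpNorm_trace_le_of_pos hs1 hs2
  refine ⟨2 * C, ENNReal.mul_ne_top (by simp) hC, fun F h0 => ?_⟩
  set N := eLpNorm (fun t => (trace F t).re) s mC with hN
  -- With `u = Re F`, polynomials `P` and `Q` are taken with real parts within `δ` of `u⁺ + δ` and
  -- `u⁻ + δ`. The positive case bounds `P` and `Q`, and the remainder `F - (P - Q)` has a uniformly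
  -- small real part. Letting `δ` tend to `0` leaves `2 C N`.
  have key : ∀ δ : ℝ, 0 < δ →
      eLpNorm (trace F) s mC ≤ 2 * C * N + (4 * C + 8) * ENNReal.ofReal δ := by
    intro δ hδ
    let u : C(Circ, ℝ) := ⟨fun t => (trace F t).re, continuous_re_trace F⟩
    -- The shift by `δ` offsets the approximation error, so that `Re P > v ≥ 0`; the price is `Re P
    -- ≤ |u| + 2δ`.
    have hpos : ∀ v : C(Circ, ℝ), (∀ t, 0 ≤ v t) → (∀ t, v t ≤ |u t|) →
        ∃ P : Polynomial ℂ, (P.eval 0).im = 0 ∧ (∀ t, |(trace P t).re - (v t + δ)| < δ) ∧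
          eLpNorm (trace P) s mC ≤ C * (N + 2 * ENNReal.ofReal δ) := by
      intro v hv hvu
      obtain ⟨P, hP0, hP⟩ := exists_abs_re_trace_sub_lt (v + ContinuousMap.const _ δ) hδ
      have hP' : ∀ t, |(trace P t).re - (v t + δ)| < δ := hP
      refine ⟨P, hP0, hP', (h P (fun t => ?_) hP0).trans ?_⟩
      · have := abs_lt.1 (hP' t)
        linarith [hv t]
      · gcongr
        have e1 : eLpNorm (fun t => (trace P t).re) s mC ≤
            eLpNorm ((fun t => |u t|) + fun _ => 2 * δ) s mC := by
          refine eLpNorm_mono_real fun t => ?_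
          have := abs_lt.1 (hP' t)
          rw [Real.norm_eq_abs, abs_le, Pi.add_apply]
          constructor <;> linarith [hv t, hvu t, abs_nonneg (u t)]
        refine e1.trans ((eLpNorm_add_le (u.continuous.abs.aestronglyMeasurable)
          aestronglyMeasurable_const hs1.le).trans ?_)
        gcongr
        · exact (eLpNorm_norm (fun t => u t)).le
        · refine (eLpNorm_le_ofReal_of_abs_le (δ := 2 * δ) (fun t => ?_) s).trans ?_
          · rw [abs_of_pos (by linarith)]
          · rw [ENNReal.ofReal_mul (by norm_num)]
            simp
    obtain ⟨P, hP0, hP, hPn⟩ := hpos (u ⊔ 0) (fun t => le_sup_right)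
      (fun t => sup_le (le_abs_self _) (abs_nonneg _))
    obtain ⟨Q, hQ0, hQ, hQn⟩ := hpos (-u ⊔ 0) (fun t => le_sup_right)
      (fun t => sup_le (neg_le_abs _) (abs_nonneg _))
    have hR0 : ((F - (P - Q)).eval 0).im = 0 := by simp [h0, hP0, hQ0]
    -- The real part of the remainder has no sign, so the estimate for exponent `2` is used. It
    -- dominates the `L^s` norm because `s ≤ 2` and the measure has mass one. The two shifts by `δ`
    -- cancel in `P - Q`, leaving an error of at most `2δ`.
    have hR : eLpNorm (trace (F - (P - Q))) s mC ≤ 4 * ENNReal.ofReal δ := by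
      refine (eLpNorm_le_eLpNorm_of_exponent_le hs2
        (map_continuous _).aestronglyMeasurable).trans ((eLpNorm_two_trace_le hR0).trans ?_)
      rw [show (4 : ℝ≥0∞) = 2 * 2 by norm_num, mul_assoc]
      gcongr
      have : (2 : ℝ≥0∞) * ENNReal.ofReal δ = ENNReal.ofReal (2 * δ) := by
        rw [ENNReal.ofReal_mul (by norm_num)]; simp
      rw [this]
      refine eLpNorm_le_ofReal_of_abs_le (fun t => ?_) 2
      have e1 := abs_lt.1 (hP t)
      have e2 := abs_lt.1 (hQ t)
      have e3 : (trace (F - (P - Q)) t).re = u t - ((trace P t).re - (trace Q t).re) := by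
        simp [trace_sub, u]
      have e4 : (u ⊔ 0) t - (-u ⊔ 0) t = u t := by
        simp only [ContinuousMap.sup_apply, ContinuousMap.neg_apply, ContinuousMap.zero_apply]
        rcases le_total (u t) 0 with hu | hu <;> simp [hu]
      rw [e3, abs_le]
      constructor <;> linarith
    have eF : (trace F : Circ → ℂ) = trace (F - (P - Q)) + (trace P - trace Q) := by
      ext t; simp [trace_sub]
    have m := fun P : Polynomial ℂ => (map_continuous (trace P)).aestronglyMeasurable (μ := mC)
    calc eLpNorm (trace F) s mC
        ≤ eLpNorm (trace (F - (P - Q))) s mC + eLpNorm (trace P - trace Q) s mC := by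
          rw [eF]; exact eLpNorm_add_le (m _) ((m P).sub (m Q)) hs1.le
      _ ≤ eLpNorm (trace (F - (P - Q))) s mC + (eLpNorm (trace P) s mC
            + eLpNorm (trace Q) s mC) := by
          gcongr; exact eLpNorm_sub_le (m P) (m Q) hs1.le
      _ ≤ 4 * ENNReal.ofReal δ + (C * (N + 2 * ENNReal.ofReal δ)
            + C * (N + 2 * ENNReal.ofReal δ)) := by gcongr
      _ = 2 * C * N + (4 * C + 4) * ENNReal.ofReal δ := by ring
      _ ≤ _ := by gcongr; norm_num
  have hK : (4 * C + 8) ≠ ∞ := by finiteness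
  have hlim : Filter.Tendsto (fun δ : ℝ => 2 * C * N + (4 * C + 8) * ENNReal.ofReal δ)
      (nhdsWithin 0 (Set.Ioi 0)) (nhds (2 * C * N + (4 * C + 8) * 0)) := by
    refine tendsto_const_nhds.add (ENNReal.Tendsto.const_mul ?_ (Or.inr hK))
    have := (ENNReal.continuous_ofReal.tendsto 0).mono_left (nhdsWithin_le_nhds (s := Set.Ioi 0))
    simpa using this
  rw [mul_zero, add_zero] at hlim
  exact ge_of_tendsto hlim (eventually_nhdsWithin_of_forall key)

/-! ### Fourier coefficients and the analytic completion of a real function -/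

theorem norm_fourierCoeff_sub_le {E : Type*} [NormedAddCommGroup E] [NormedSpace ℂ E]
    {s : ℝ≥0∞} (hs : 1 ≤ s) {f g : Circ → E} (hf : MemLp f s mC) (hg : MemLp g s mC) (k : ℤ) :
    ‖fourierCoeff f k - fourierCoeff g k‖ ≤ (eLpNorm (f - g) s mC).toReal := by
  have hfi := hf.integrable hs
  have hgi := hg.integrable hs
  have e : fourierCoeff f k - fourierCoeff g k = ∫ t, fourier (-k) t • (f - g) t ∂mC := by
    rw [fourierCoeff, fourierCoeff, ← integral_sub (hfi.fourier_smul _) (hgi.fourier_smul _)]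
    simp only [Pi.sub_apply, smul_sub]
  have h1 : ‖∫ t, fourier (-k) t • (f - g) t ∂mC‖ ≤ ∫ t, ‖(f - g) t‖ ∂mC := by
    refine (norm_integral_le_integral_norm _).trans (le_of_eq ?_)
    refine integral_congr_ae (Filter.Eventually.of_forall fun t => ?_)
    change ‖fourier (-k) t • (f - g) t‖ = ‖(f - g) t‖
    rw [norm_smul, fourier_apply, Circle.norm_coe, one_mul]
  have h2 : ∫ t, ‖(f - g) t‖ ∂mC = (eLpNorm (f - g) 1 mC).toReal := by
    rw [eLpNorm_one_eq_lintegral_enorm,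
      integral_norm_eq_lintegral_enorm (hfi.sub hgi).aestronglyMeasurable]
  rw [e]
  refine h1.trans (h2.le.trans (ENNReal.toReal_mono (hf.sub hg).eLpNorm_ne_top
    (eLpNorm_le_eLpNorm_of_exponent_le hs (hf.sub hg).aestronglyMeasurable)))

theorem fourierCoeff_conj (f : Circ → ℂ) (k : ℤ) :
    fourierCoeff (fun t => star (f t)) k = star (fourierCoeff f (-k)) := by
  rw [fourierCoeff, fourierCoeff]
  simp only [RCLike.star_def]
  rw [← integral_conj]
  refine integral_congr_ae (Filter.Eventually.of_forall fun t => ?_)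
  simp only [smul_eq_mul, map_mul, neg_neg]
  rw [fourier_neg]

/-- The coefficient is the mean of `z^m F(z)` with `m = -k > 0`, a polynomial vanishing at the
origin. -/
theorem fourierCoeff_trace_of_neg (F : Polynomial ℂ) {k : ℤ} (hk : k < 0) :
    fourierCoeff (trace F) k = 0 := by
  obtain ⟨m, hm⟩ := Int.eq_ofNat_of_zero_le (by lia : 0 ≤ -k)
  have hm0 : m ≠ 0 := by rintro rfl; simp at hm; lia
  have := integral_comp_fourier_one (φ := fun z => z ^ m * F.eval z)
    ((differentiable_id.pow m).mul F.differentiable).diffContOnCl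
  simp only [ne_eq, hm0, not_false_eq_true, zero_pow, zero_mul] at this
  rw [fourierCoeff, ← this, hm]
  refine integral_congr_ae (Filter.Eventually.of_forall fun t => ?_)
  simp [trace_apply, fourier_apply, AddCircle.toCircle_nsmul]

theorem fourierCoeff_trace_zero (F : Polynomial ℂ) : fourierCoeff (trace F) 0 = F.eval 0 := by
  have := integral_comp_fourier_one F.differentiable.diffContOnCl
  rw [fourierCoeff, ← this]
  refine integral_congr_ae (Filter.Eventually.of_forall fun t => ?_)
  simp [trace_apply]

theorem fourierCoeff_re_trace (F : Polynomial ℂ) (k : ℤ) :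
    2 * fourierCoeff (fun t => ((trace F t).re : ℂ)) k =
      fourierCoeff (trace F) k + star (fourierCoeff (trace F) (-k)) := by
  have hc := map_continuous (trace F)
  rw [← fourierCoeff_conj, ← fourierCoeff.const_mul, ← Pi.add_apply (fourierCoeff _),
    ← fourierCoeff.add (integrable_of_continuous hc) (integrable_of_continuous hc.star)]
  congr 1
  ext t
  rw [Pi.add_apply, RCLike.star_def, Complex.add_conj]
  push_cast
  ring

theorem exists_eLpNorm_sub_re_trace_le {s : ℝ≥0∞} (hs1 : 1 ≤ s) (hs : s ≠ ∞) {f : Circ → ℝ}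
    (hf : MemLp f s mC) {δ : ℝ} (hδ : 0 < δ) :
    ∃ F : Polynomial ℂ, (F.eval 0).im = 0 ∧
      eLpNorm (f - fun t => (trace F t).re) s mC ≤ ENNReal.ofReal δ := by
  obtain ⟨g, hg, hgm⟩ := hf.exists_boundedContinuous_eLpNorm_sub_le hs
    (ε := ENNReal.ofReal (δ / 2)) (by simpa using hδ)
  obtain ⟨F, h0, hF⟩ := exists_abs_re_trace_sub_lt ⟨g, map_continuous g⟩ (half_pos hδ)
  refine ⟨F, h0, ?_⟩
  have e : (f - fun t => (trace F t).re) = (f - g) + (g - fun t => (trace F t).re) := by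
    ext t; simp
  have hm := (continuous_re_trace F).aestronglyMeasurable (μ := mC)
  rw [e, ← add_halves δ, ENNReal.ofReal_add (half_pos hδ).le (half_pos hδ).le]
  refine (eLpNorm_add_le (hf.1.sub hgm.1) (hgm.1.sub hm) hs1).trans (add_le_add hg ?_)
  refine eLpNorm_le_ofReal_of_abs_le (fun t => ?_) s
  have := (hF t).le
  rwa [abs_sub_comm] at this

/-- `g` is the analytic function with real part `f` and real mean. Analytic polynomials `F m` with
`Re (F m) → f` in `L^s` form a Cauchy sequence by the Riesz inequality applied to differences, and
`g` is their limit. Its coefficients follow by continuity from `2 Re F = F + conj F`. -/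
theorem exists_analytic_of_real {s : ℝ≥0∞} (hs1 : 1 < s) (hs2 : s ≤ 2) {f : Circ → ℝ}
    (hf : MemLp f s mC) : ∃ g : Circ → ℂ, MemLp g s mC ∧ (∀ k : ℤ, k < 0 → fourierCoeff g k = 0) ∧
      fourierCoeff g 0 = fourierCoeff (fun t => (f t : ℂ)) 0 ∧
      ∀ k : ℤ, 0 < k → fourierCoeff g k = 2 * fourierCoeff (fun t => (f t : ℂ)) k := by
  have hs : s ≠ ∞ := ne_top_of_le_ne_top (by simp) hs2
  have : Fact (1 ≤ s) := ⟨hs1.le⟩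
  obtain ⟨C, hC, hCF⟩ := exists_eLpNorm_trace_le hs1 hs2
  have hδ : ∀ m : ℕ, 0 < 1 / ((m : ℝ) + 1) := fun m => Nat.one_div_pos_of_nat
  choose F hF0 hF using fun m : ℕ => exists_eLpNorm_sub_re_trace_le hs1.le hs hf (hδ m)
  have hm : ∀ P : Polynomial ℂ, MemLp (trace P) s mC :=
    fun P => memLp_of_continuous (map_continuous _) s
  have hre : ∀ P : Polynomial ℂ, MemLp (fun t => (trace P t).re) s mC := fun P => (hm P).re
  let x : ℕ → Lp ℂ s mC := fun m => (hm (F m)).toLp _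
  have hlim0 := tendsto_one_div_add_atTop_nhds_zero_nat (𝕜 := ℝ)
  have hcauchy : CauchySeq x := by
    refine cauchySeq_of_le_tendsto_0' (fun m => C.toReal * (1 / ((m : ℝ) + 1) + 1 / ((m : ℝ) + 1)))
      (fun m l hml => ?_) (by simpa using (hlim0.add hlim0).const_mul C.toReal)
    rw [dist_eq_norm, ← MemLp.toLp_sub, Lp.norm_toLp]
    have e1 : eLpNorm (trace (F m) - trace (F l)) s mC ≤
        C * (ENNReal.ofReal (1 / ((m : ℝ) + 1)) + ENNReal.ofReal (1 / ((m : ℝ) + 1))) := by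
      have := hCF (F m - F l) (by simp [hF0])
      rw [trace_sub] at this
      refine this.trans ?_
      gcongr
      have e2 : (fun t => ((trace (F m) - trace (F l)) t).re) =
          (f - fun t => (trace (F l) t).re) - (f - fun t => (trace (F m) t).re) := by
        ext t; simp
      rw [e2]
      refine (eLpNorm_sub_le (hf.sub (hre _)).1 (hf.sub (hre _)).1 hs1.le).trans
        (add_le_add ((hF l).trans ?_) (hF m))
      exact ENNReal.ofReal_le_ofReal (Nat.one_div_le_one_div hml)
    refine (ENNReal.toReal_mono (by finiteness) e1).trans_eq ?_
    rw [ENNReal.toReal_mul, ENNReal.toReal_add (by simp) (by simp), ENNReal.toReal_ofReal (hδ m).le]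
  obtain ⟨g, hg⟩ := cauchySeq_tendsto_of_complete hcauchy
  have hfc : MemLp (fun t => (f t : ℂ)) s mC := hf.ofReal
  have hrec : ∀ P : Polynomial ℂ, MemLp (fun t => ((trace P t).re : ℂ)) s mC :=
    fun P => (hre P).ofReal
  have hgk : ∀ k, Filter.Tendsto (fun m => fourierCoeff (trace (F m)) k) Filter.atTop
      (nhds (fourierCoeff g k)) := by
    intro k
    rw [tendsto_iff_norm_sub_tendsto_zero]
    refine squeeze_zero (fun _ => norm_nonneg _)
      (fun m => norm_fourierCoeff_sub_le hs1.le (hm (F m)) (Lp.memLp g) k) ?_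
    rw [tendsto_iff_norm_sub_tendsto_zero] at hg
    refine hg.congr fun m => ?_
    rw [Lp.norm_def]
    congr 1
    refine eLpNorm_congr_ae ?_
    filter_upwards [Lp.coeFn_sub (x m) g, (hm (F m)).coeFn_toLp] with t h1 h2
    rw [h1, Pi.sub_apply, Pi.sub_apply, ← h2]
  have hfk : ∀ k, Filter.Tendsto (fun m => fourierCoeff (fun t => ((trace (F m) t).re : ℂ)) k)
      Filter.atTop (nhds (fourierCoeff (fun t => (f t : ℂ)) k)) := by
    intro k
    rw [tendsto_iff_norm_sub_tendsto_zero]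
    refine squeeze_zero (fun _ => norm_nonneg _)
      (fun m => ?_) hlim0
    rw [norm_sub_rev]
    refine (norm_fourierCoeff_sub_le hs1.le hfc (hrec (F m)) k).trans ?_
    rw [← ENNReal.toReal_ofReal (hδ m).le]
    refine ENNReal.toReal_mono (by simp) (le_trans (le_of_eq ?_) (hF m))
    refine eLpNorm_congr_norm_ae (Filter.Eventually.of_forall fun t => ?_)
    rw [Pi.sub_apply, Pi.sub_apply, ← Complex.ofReal_sub, Complex.norm_real]
  refine ⟨g, Lp.memLp g, fun k hk => ?_, ?_, fun k hk => ?_⟩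
  · refine tendsto_nhds_unique (hgk k) ?_
    simp only [fourierCoeff_trace_of_neg _ hk]
    exact tendsto_const_nhds
  · refine tendsto_nhds_unique ((hgk 0).congr fun m => ?_) (hfk 0)
    have h := fourierCoeff_re_trace (F m) 0
    rw [neg_zero, fourierCoeff_trace_zero, RCLike.star_def, Complex.conj_eq_iff_im.2 (hF0 m),
      ← two_mul] at h
    rw [fourierCoeff_trace_zero]
    exact (mul_left_cancel₀ two_ne_zero h).symm
  · refine tendsto_nhds_unique ((hgk k).congr fun m => ?_) ((hfk k).const_mul 2)
    rw [fourierCoeff_re_trace, fourierCoeff_trace_of_neg _ (by lia : -k < 0), star_zero, add_zero]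

/-- Existence of the scalar Riesz projection. -/
theorem exists_scalar_rieszProj {s : ℝ≥0∞} (hs1 : 1 < s) (hs2 : s ≤ 2) {f : Circ → ℂ}
    (hf : MemLp f s mC) : ∃ g : Circ → ℂ, MemLp g s mC ∧ (∀ k : ℤ, k < 0 → fourierCoeff g k = 0) ∧
      ∀ k : ℤ, 0 ≤ k → fourierCoeff g k = fourierCoeff f k := by
  have hreal : ∀ f : Circ → ℝ, MemLp f s mC → ∃ g : Circ → ℂ, MemLp g s mC ∧
      (∀ k : ℤ, k < 0 → fourierCoeff g k = 0) ∧
      ∀ k : ℤ, 0 ≤ k → fourierCoeff g k = fourierCoeff (fun t => (f t : ℂ)) k := by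
    intro f hf
    obtain ⟨g, hg, hneg, h0, hpos⟩ := exists_analytic_of_real hs1 hs2 hf
    -- Halving `g` gives the right coefficients of positive index but only half the mean. Hence `(g
    -- + c) / 2` is the analytic part of `f`.
    set c := fourierCoeff (fun t => (f t : ℂ)) 0
    have hc : Continuous fun t : Circ => c * fourier 0 t := continuous_const.mul (map_continuous _)
    have hcm := memLp_of_continuous hc s
    have hk : ∀ k, fourierCoeff (fun t => (1 / 2 : ℂ) * (g + fun t => c * fourier 0 t : Circ → ℂ) t) k =
        1 / 2 * (fourierCoeff g k + c * if k = 0 then 1 else 0) := by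
      intro k
      rw [fourierCoeff.const_mul, fourierCoeff.add (hg.integrable hs1.le)
        (integrable_of_continuous hc), Pi.add_apply, fourierCoeff.const_mul, fourierCoeff_fourier]
      simp [Pi.single_apply]
    refine ⟨fun t => (1 / 2 : ℂ) * (g + fun t => c * fourier 0 t : Circ → ℂ) t, (hg.add hcm).const_mul _,
      fun k hk0 => ?_, fun k hk0 => ?_⟩
    · rw [hk, hneg k hk0, if_neg hk0.ne]
      simp
    · rw [hk]
      rcases hk0.eq_or_lt with rfl | hk0
      · rw [h0, if_pos rfl]; ring
      · rw [hpos k hk0, if_neg hk0.ne']; ring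
  obtain ⟨g₁, hg₁, hn₁, hp₁⟩ := hreal _ hf.re
  obtain ⟨g₂, hg₂, hn₂, hp₂⟩ := hreal _ hf.im
  have hk : ∀ k, fourierCoeff (g₁ + fun t => Complex.I * g₂ t) k =
      fourierCoeff g₁ k + Complex.I * fourierCoeff g₂ k := by
    intro k
    rw [fourierCoeff.add (hg₁.integrable hs1.le) ((hg₂.integrable hs1.le).const_mul _),
      Pi.add_apply, fourierCoeff.const_mul]
  refine ⟨g₁ + fun t => Complex.I * g₂ t, hg₁.add (hg₂.const_mul _), fun k hk0 => ?_,
    fun k hk0 => ?_⟩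
  · rw [hk, hn₁ k hk0, hn₂ k hk0]
    simp
  · rw [hk, hp₁ k hk0, hp₂ k hk0, ← fourierCoeff.const_mul, ← Pi.add_apply (fourierCoeff _),
      ← fourierCoeff.add (hf.re.ofReal.integrable hs1.le) ((hf.im.ofReal.integrable hs1.le).const_mul _)]
    congr 1
    ext t
    simp [mul_comm Complex.I, Complex.re_add_im]

/-! ### Vector-valued trigonometric polynomials and the Riesz projection -/

theorem fourierCoeff_compLpL {E F : Type*} [NormedAddCommGroup E] [NormedSpace ℂ E]
    [CompleteSpace E] [NormedAddCommGroup F] [NormedSpace ℂ F] [CompleteSpace F]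
    {s : ℝ≥0∞} [hs : Fact (1 ≤ s)] (L : E →L[ℂ] F) (f : Lp E s mC) (k : ℤ) :
    fourierCoeff (L.compLpL s mC f) k = L (fourierCoeff f k) := by
  rw [fourierCoeff_congr_ae (L.coeFn_compLpL f), fourierCoeff, fourierCoeff,
    ← L.integral_comp_comm (((Lp.memLp f).integrable hs.out).fourier_smul _)]
  simp only [map_smul]

/-- The embedding `f ↦ f v` of scalar functions into vector functions. -/
def tensorLp {n : ℕ} (s : ℝ≥0∞) [Fact (1 ≤ s)] (v : Cn n) : Lp ℂ s mC →L[ℂ] LpVec n s :=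
  (ContinuousLinearMap.toSpanSingleton ℂ v).compLpL s mC

theorem fourierCoeff_tensorLp {n : ℕ} {s : ℝ≥0∞} [Fact (1 ≤ s)] (v : Cn n) (f : Lp ℂ s mC)
    (k : ℤ) : fourierCoeff (tensorLp s v f) k = fourierCoeff f k • v := by
  rw [tensorLp, fourierCoeff_compLpL, ContinuousLinearMap.toSpanSingleton_apply]

theorem sum_tensorLp {n : ℕ} {s : ℝ≥0∞} [Fact (1 ≤ s)] (f : LpVec n s) :
    ∑ i, tensorLp s (EuclideanSpace.single i 1)
      ((EuclideanSpace.proj i : Cn n →L[ℂ] ℂ).compLpL s mC f) = f := by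
  refine Lp.ext ?_
  have h1 : ∀ i, ∀ᵐ t ∂mC, tensorLp s (EuclideanSpace.single i 1)
      ((EuclideanSpace.proj i : Cn n →L[ℂ] ℂ).compLpL s mC f) t =
      f t i • EuclideanSpace.single i 1 := by
    intro i
    filter_upwards [(ContinuousLinearMap.toSpanSingleton ℂ
      (EuclideanSpace.single i 1 : Cn n)).coeFn_compLpL (p := s) (μ := mC)
      ((EuclideanSpace.proj i : Cn n →L[ℂ] ℂ).compLpL s mC f),
      (EuclideanSpace.proj i : Cn n →L[ℂ] ℂ).coeFn_compLpL f] with t h1 h2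
    rw [tensorLp, h1, h2, ContinuousLinearMap.toSpanSingleton_apply]
    rfl
  filter_upwards [Lp.coeFn_finsetSum Finset.univ fun i => tensorLp s (EuclideanSpace.single i 1)
      ((EuclideanSpace.proj i : Cn n →L[ℂ] ℂ).compLpL s mC f),
    ae_all_iff.2 h1] with t ht h
  rw [ht, Finset.sum_apply]
  simp only [h]
  ext j
  simp [Finset.sum_apply, Pi.single_apply]

/-- The function `t ↦ exp (i k t) v`. -/
def expLp {n : ℕ} (s : ℝ≥0∞) [Fact (1 ≤ s)] (k : ℤ) (v : Cn n) : LpVec n s :=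
  tensorLp s v (fourierLp s k)

theorem coeFn_expLp {n : ℕ} {s : ℝ≥0∞} [Fact (1 ≤ s)] (k : ℤ) (v : Cn n) :
    expLp s k v =ᵐ[mC] fun t => fourier k t • v := by
  filter_upwards [(ContinuousLinearMap.toSpanSingleton ℂ v).coeFn_compLpL (p := s) (μ := mC)
    (fourierLp s k), coeFn_fourierLp s k] with t h1 h2
  rw [expLp, tensorLp, h1, h2, ContinuousLinearMap.toSpanSingleton_apply]

theorem fourierCoeff_expLp {n : ℕ} {s : ℝ≥0∞} [Fact (1 ≤ s)] (k j : ℤ) (v : Cn n) :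
    fourierCoeff (expLp s k v) j = if j = k then v else 0 := by
  rw [expLp, fourierCoeff_tensorLp, fourierCoeff_congr_ae (coeFn_fourierLp s k),
    fourierCoeff_fourier, Pi.single_apply]
  split_ifs <;> simp

theorem expLp_mem_hardy {n : ℕ} {s : ℝ≥0∞} [Fact (1 ≤ s)] {k : ℤ} (hk : 0 ≤ k) (v : Cn n) :
    expLp s k v ∈ hardy n s :=
  mem_hardy.2 fun j hj => by rw [fourierCoeff_expLp, if_neg (by lia)]

theorem expLp_mem_conjHardyZero {n : ℕ} {s : ℝ≥0∞} [Fact (1 ≤ s)] {k : ℤ} (hk : k < 0)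
    (v : Cn n) : expLp s k v ∈ conjHardyZero n s :=
  mem_conjHardyZero.2 fun j hj => by rw [fourierCoeff_expLp, if_neg (by lia)]

/-- Trigonometric polynomials are dense: a bounded operator is determined by them. -/
theorem eq_zero_of_expLp {n : ℕ} {s : ℝ≥0∞} [Fact (1 ≤ s)] (hs : s ≠ ∞) {E : Type*}
    [NormedAddCommGroup E] [NormedSpace ℂ E] (L : LpVec n s →L[ℂ] E)
    (h : ∀ k v, L (expLp s k v) = 0) : L = 0 := by
  have h1 : ∀ v : Cn n, L ∘L tensorLp s v = 0 := by
    intro v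
    refine ContinuousLinearMap.ext_on (s := Set.range (@fourierLp (2 * Real.pi) _ s _)) ?_ ?_
    · rw [Submodule.dense_iff_topologicalClosure_eq_top]
      exact span_fourierLp_closure_eq_top hs
    · rintro _ ⟨k, rfl⟩
      exact h k v
  ext f
  rw [← sum_tensorLp f, map_sum]
  exact Finset.sum_eq_zero fun i _ => DFunLike.congr_fun (h1 _) _

theorem exists_isRieszProj {n : ℕ} {s : ℝ≥0∞} [Fact (1 ≤ s)] (hs1 : 1 < s) (hs2 : s ≤ 2)
    (f : LpVec n s) : ∃ g, IsRieszProj f g := by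
  have h : ∀ φ : Lp ℂ s mC, ∀ v : Cn n, ∃ g, IsRieszProj (tensorLp s v φ) g := by
    intro φ v
    obtain ⟨g, hg, hneg, hpos⟩ := exists_scalar_rieszProj hs1 hs2 (Lp.memLp φ)
    refine ⟨tensorLp s v (hg.toLp g), mem_hardy.2 fun k hk => ?_,
      mem_conjHardyZero.2 fun k hk => ?_⟩
    · rw [fourierCoeff_tensorLp, fourierCoeff_congr_ae hg.coeFn_toLp, hneg k hk, zero_smul]
    · change coeffLin n s k _ = 0
      rw [map_sub, sub_eq_zero]
      change fourierCoeff _ k = fourierCoeff _ k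
      rw [fourierCoeff_tensorLp, fourierCoeff_tensorLp, fourierCoeff_congr_ae hg.coeFn_toLp,
        hpos k hk]
  choose g hg using fun i => h ((EuclideanSpace.proj i : Cn n →L[ℂ] ℂ).compLpL s mC f)
    (EuclideanSpace.single i 1)
  refine ⟨∑ i, g i, Submodule.sum_mem _ fun i _ => (hg i).1, ?_⟩
  nth_rw 1 [← sum_tensorLp f]
  rw [← Finset.sum_sub_distrib]
  exact Submodule.sum_mem _ fun i _ => (hg i).2

/-- Existence and uniqueness of the projection say that the two spaces are algebraic complements.
Both are closed in a Banach space, so boundedness of the projection is automatic and no norm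
estimate for it has to be carried along. -/
theorem isTopCompl_hardy (n : ℕ) {s : ℝ≥0∞} [Fact (1 ≤ s)] (hs1 : 1 < s) (hs2 : s ≤ 2) :
    Submodule.IsTopCompl (hardy n s) (conjHardyZero n s) := by
  refine Submodule.IsCompl.isTopCompl_of_isClosed ⟨?_, ?_⟩ (isClosed_hardy n s)
    (isClosed_conjHardyZero n s)
  · rw [Submodule.disjoint_def]
    exact fun f => eq_zero_of_mem_hardy_of_mem_conjHardyZero
  · rw [codisjoint_iff, Submodule.eq_top_iff']
    intro f
    obtain ⟨g, hg⟩ := exists_isRieszProj hs1 hs2 f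
    exact Submodule.mem_sup.2 ⟨g, hg.1, f - g, hg.2, by abel⟩

/-- The Riesz projection `P_{s+}` as a bounded operator. -/
def riesz {n : ℕ} {s : ℝ≥0∞} [Fact (1 ≤ s)] (hs1 : 1 < s) (hs2 : s ≤ 2) :
    LpVec n s →L[ℂ] hardy n s :=
  (hardy n s).projectionOntoL (conjHardyZero n s) (isTopCompl_hardy n hs1 hs2)

theorem isRieszProj_riesz {n : ℕ} {s : ℝ≥0∞} [Fact (1 ≤ s)] (hs1 : 1 < s) (hs2 : s ≤ 2)
    (f : LpVec n s) : IsRieszProj f (riesz hs1 hs2 f) := by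
  refine ⟨(riesz hs1 hs2 f).2, ?_⟩
  obtain ⟨g, hg⟩ := exists_isRieszProj hs1 hs2 f
  have h : (riesz hs1 hs2 f : LpVec n s) = g := by
    have e : f = g + (f - g) := by abel
    have h1 : riesz hs1 hs2 g = ⟨g, hg.1⟩ :=
      Submodule.projectionOnto_apply_left (isTopCompl_hardy n hs1 hs2).isCompl ⟨g, hg.1⟩
    have h2 : riesz hs1 hs2 (f - g) = 0 :=
      (Submodule.projectionOnto_apply_eq_zero_iff (isTopCompl_hardy n hs1 hs2).isCompl).2 hg.2
    rw [e, map_add, h1, h2]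
    simp
  rw [h]
  exact hg.2

theorem riesz_eq {n : ℕ} {s : ℝ≥0∞} [Fact (1 ≤ s)] (hs1 : 1 < s) (hs2 : s ≤ 2)
    {f g : LpVec n s} (h : IsRieszProj f g) : (riesz hs1 hs2 f : LpVec n s) = g :=
  (isRieszProj_riesz hs1 hs2 f).unique h

theorem isRieszProj_of_mem_hardy {n : ℕ} {s : ℝ≥0∞} [Fact (1 ≤ s)] {f : LpVec n s}
    (hf : f ∈ hardy n s) : IsRieszProj f f :=
  ⟨hf, by simp⟩

theorem isRieszProj_zero_of_mem_conjHardyZero {n : ℕ} {s : ℝ≥0∞} [Fact (1 ≤ s)] {f : LpVec n s}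
    (hf : f ∈ conjHardyZero n s) : IsRieszProj f 0 :=
  ⟨Submodule.zero_mem _, by simpa using hf⟩

/-- The bounded operator `L ∘ P_{s+}` vanishes on every exponential: those of negative index are
killed by the projection, the others by `L`. Density of trigonometric polynomials in the full space
then suffices. -/
theorem eq_zero_on_hardy {n : ℕ} {s : ℝ≥0∞} [Fact (1 ≤ s)] (hs1 : 1 < s) (hs2 : s ≤ 2)
    {E : Type*} [NormedAddCommGroup E] [NormedSpace ℂ E] (L : LpVec n s →L[ℂ] E)
    (h : ∀ k v, 0 ≤ k → L (expLp s k v) = 0) {f : LpVec n s} (hf : f ∈ hardy n s) : L f = 0 := by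
  have := eq_zero_of_expLp (ne_top_of_le_ne_top (by simp) hs2)
    (L ∘L (hardy n s).subtypeL ∘L riesz hs1 hs2) fun k v => by
      change L (riesz hs1 hs2 (expLp s k v)) = 0
      rcases lt_or_ge k 0 with hk | hk
      · rw [riesz_eq hs1 hs2
          (isRieszProj_zero_of_mem_conjHardyZero (expLp_mem_conjHardyZero hk v)), map_zero]
      · rw [riesz_eq hs1 hs2 (isRieszProj_of_mem_hardy (expLp_mem_hardy hk v)), h k v hk]
  have h2 : L (riesz hs1 hs2 f) = 0 := DFunLike.congr_fun this f
  rwa [riesz_eq hs1 hs2 (isRieszProj_of_mem_hardy hf)] at h2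

theorem eq_zero_on_conjHardyZero {n : ℕ} {s : ℝ≥0∞} [Fact (1 ≤ s)] (hs1 : 1 < s) (hs2 : s ≤ 2)
    {E : Type*} [NormedAddCommGroup E] [NormedSpace ℂ E] (L : LpVec n s →L[ℂ] E)
    (h : ∀ k v, k < 0 → L (expLp s k v) = 0) {f : LpVec n s} (hf : f ∈ conjHardyZero n s) :
    L f = 0 := by
  have := eq_zero_of_expLp (ne_top_of_le_ne_top (by simp) hs2)
    (L - L ∘L (hardy n s).subtypeL ∘L riesz hs1 hs2) fun k v => by
      change L (expLp s k v) - L (riesz hs1 hs2 (expLp s k v)) = 0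
      rcases lt_or_ge k 0 with hk | hk
      · rw [riesz_eq hs1 hs2
          (isRieszProj_zero_of_mem_conjHardyZero (expLp_mem_conjHardyZero hk v)), map_zero,
          h k v hk, sub_zero]
      · rw [riesz_eq hs1 hs2 (isRieszProj_of_mem_hardy (expLp_mem_hardy hk v)), sub_self]
  have h2 : L f - L (riesz hs1 hs2 f) = 0 := DFunLike.congr_fun this f
  rwa [riesz_eq hs1 hs2 (isRieszProj_zero_of_mem_conjHardyZero hf), map_zero, sub_zero] at h2

/-! ### Multiplication operators -/

theorem norm_mulVec_le {n : ℕ} (M : Matrix (Fin n) (Fin n) ℂ) (v : Cn n) :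
    ‖(WithLp.toLp 2 (M *ᵥ WithLp.ofLp v) : Cn n)‖ ≤ (∑ i, ∑ j, ‖M i j‖) * ‖v‖ := by
  have e : (WithLp.toLp 2 (M *ᵥ WithLp.ofLp v) : Cn n) =
      ∑ i, EuclideanSpace.single i ((M *ᵥ WithLp.ofLp v) i) := by
    ext j
    simp [Pi.single_apply]
  rw [e, Finset.sum_mul]
  refine (norm_sum_le _ _).trans (Finset.sum_le_sum fun i _ => ?_)
  rw [PiLp.norm_single, Matrix.mulVec, dotProduct, Finset.sum_mul]
  refine (norm_sum_le _ _).trans (Finset.sum_le_sum fun j _ => ?_)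
  rw [norm_mul]
  gcongr
  exact PiLp.norm_apply_le v j

/-- Multiplication by a matrix function as a bounded operator. -/
def mulL {n : ℕ} {M : Circ → Matrix (Fin n) (Fin n) ℂ} {a : ℝ≥0∞} (hM : MatrixMemLp M a)
    (b c : ℝ≥0∞) [ENNReal.HolderTriple a b c] [Fact (1 ≤ b)] [Fact (1 ≤ c)] :
    LpVec n b →L[ℂ] LpVec n c :=
  (mulLp hM b c).mkContinuous (eLpNorm (fun t => ∑ i, ∑ j, ‖M t i j‖) a mC).toReal fun f => by
    have hm : MemLp (fun t => ∑ i, ∑ j, ‖M t i j‖) a mC :=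
      memLp_finsetSum _ fun i _ => memLp_finsetSum _ fun j _ => (hM i j).norm
    rw [Lp.norm_def, Lp.norm_def, ← ENNReal.toReal_mul]
    refine ENNReal.toReal_mono (ENNReal.mul_ne_top hm.2.ne (Lp.memLp f).2.ne) ?_
    rw [eLpNorm_congr_ae (coeFn_mulLp hM b c f), ← eLpNorm_norm f]
    refine (eLpNorm_mono_real fun t => ?_).trans
      (eLpNorm_smul_le_mul_eLpNorm (Lp.memLp f).1.norm hm.1)
    exact norm_mulVec_le _ _

theorem mulL_apply {n : ℕ} {M : Circ → Matrix (Fin n) (Fin n) ℂ} {a : ℝ≥0∞}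
    (hM : MatrixMemLp M a) (b c : ℝ≥0∞) [ENNReal.HolderTriple a b c] [Fact (1 ≤ b)]
    [Fact (1 ≤ c)] (f : LpVec n b) : mulL hM b c f = mulLp hM b c f := rfl

/-- Multiplication by an exponential shifts the spectrum. This reduces the action of `Θ` and `Θ^*`
on the Hardy spaces to the signs of the indices in the spectrum of the symbol. -/
theorem fourierCoeff_mulLp_expLp {n : ℕ} {M : Circ → Matrix (Fin n) (Fin n) ℂ} {a : ℝ≥0∞}
    (hM : MatrixMemLp M a) (b c : ℝ≥0∞) [ENNReal.HolderTriple a b c] [Fact (1 ≤ b)]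
    [Fact (1 ≤ c)] (ha : 1 ≤ a) (j k : ℤ) (v : Cn n) (i : Fin n) :
    fourierCoeff (mulLp hM b c (expLp b j v)) k i =
      ∑ l, fourierCoeff (fun t => M t i l) (k - j) * v l := by
  refine (fourierCoeff_compLpL (EuclideanSpace.proj i : Cn n →L[ℂ] ℂ)
    (mulLp hM b c (expLp b j v)) k).symm.trans ?_
  have e : ((EuclideanSpace.proj i : Cn n →L[ℂ] ℂ).compLpL c mC (mulLp hM b c (expLp b j v)))
      =ᵐ[mC] fun t => ∑ l, fourier j t * M t i l * v l := by
    filter_upwards [(EuclideanSpace.proj i : Cn n →L[ℂ] ℂ).coeFn_compLpL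
      (mulLp hM b c (expLp b j v)), coeFn_mulLp hM b c (expLp b j v),
      coeFn_expLp (s := b) j v] with t h1 h2 h3
    rw [h1, h2, mulVecFun, h3]
    change ∑ l, M t i l * (fourier j t • v) l = _
    refine Finset.sum_congr rfl fun l _ => ?_
    simp only [PiLp.smul_apply, smul_eq_mul]
    ring
  rw [fourierCoeff_congr_ae e, fourierCoeff]
  simp only [smul_eq_mul, Finset.mul_sum]
  rw [integral_finsetSum]
  · refine Finset.sum_congr rfl fun l _ => ?_
    rw [fourierCoeff, ← integral_mul_const]
    congr 1
    ext t
    rw [← mul_assoc, ← mul_assoc, ← fourier_add, smul_eq_mul]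
    congr 3
    ring_nf
  · intro l _
    have := ((((hM i l).integrable ha).fourier_smul j).fourier_smul (-k)).mul_const (v l)
    refine this.congr (Filter.Eventually.of_forall fun t => ?_)
    simp only [smul_eq_mul]
    ring

/-! ### Inner functions and Hardy spaces -/

section InnerFunctions

variable {n : ℕ} {Θ : Circ → Matrix (Fin n) (Fin n) ℂ}

theorem mulInner_mem_hardy (hΘ : IsInner Θ) {s : ℝ≥0∞} [Fact (1 ≤ s)] (hs1 : 1 < s)
    (hs2 : s ≤ 2) {f : LpVec n s} (hf : f ∈ hardy n s) : mulInner hΘ s f ∈ hardy n s := by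
  refine mem_hardy.2 fun k hk => ?_
  let c : LpVec n s →L[ℂ] Cn n := ⟨coeffLin n s k, continuous_coeffLin n s k⟩
  refine eq_zero_on_hardy hs1 hs2 (c ∘L mulL hΘ.memLp s s) (fun j v hj => ?_) hf
  ext i
  refine (fourierCoeff_mulLp_expLp hΘ.memLp s s le_top j k v i).trans ?_
  exact Finset.sum_eq_zero fun l _ => by rw [hΘ.analytic i l _ (by lia), zero_mul]

theorem fourierCoeff_adj (hΘ : IsInner Θ) (i l : Fin n) {k : ℤ} (hk : 0 < k) :
    fourierCoeff (fun t => adj Θ t i l) k = 0 :=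
  (fourierCoeff_conj (fun t => Θ t l i) k).trans (by rw [hΘ.analytic l i _ (by lia), star_zero])

theorem mulInnerAdj_mem_conjHardyZero (hΘ : IsInner Θ) {s : ℝ≥0∞} [Fact (1 ≤ s)] (hs1 : 1 < s)
    (hs2 : s ≤ 2) {f : LpVec n s} (hf : f ∈ conjHardyZero n s) :
    mulInnerAdj hΘ s f ∈ conjHardyZero n s := by
  refine mem_conjHardyZero.2 fun k hk => ?_
  let c : LpVec n s →L[ℂ] Cn n := ⟨coeffLin n s k, continuous_coeffLin n s k⟩
  refine eq_zero_on_conjHardyZero hs1 hs2 (c ∘L mulL hΘ.memLp.adj s s) (fun j v hj => ?_) hf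
  ext i
  refine (fourierCoeff_mulLp_expLp hΘ.memLp.adj s s le_top j k v i).trans ?_
  exact Finset.sum_eq_zero fun l _ => by rw [fourierCoeff_adj hΘ i l (by lia), zero_mul]

theorem mulInnerAdj_mulInner (hΘ : IsInner Θ) {s : ℝ≥0∞} (f : LpVec n s) :
    mulInnerAdj hΘ s (mulInner hΘ s f) = f := by
  refine Lp.ext ?_
  filter_upwards [coeFn_mulLp hΘ.memLp.adj s s (mulInner hΘ s f), coeFn_mulLp hΘ.memLp s s f,
    hΘ.unitary] with t h1 h2 hu
  rw [mulInnerAdj, h1, mulVecFun, mulInner, h2]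
  simp only [mulVecFun, Matrix.mulVec_mulVec, adj]
  rw [← Matrix.star_eq_conjTranspose, (Unitary.mem_iff.1 hu).1, Matrix.one_mulVec]

theorem mulInner_mulInnerAdj (hΘ : IsInner Θ) {s : ℝ≥0∞} (f : LpVec n s) :
    mulInner hΘ s (mulInnerAdj hΘ s f) = f := by
  refine Lp.ext ?_
  filter_upwards [coeFn_mulLp hΘ.memLp s s (mulInnerAdj hΘ s f), coeFn_mulLp hΘ.memLp.adj s s f,
    hΘ.unitary] with t h1 h2 hu
  rw [mulInner, h1, mulVecFun, mulInnerAdj, h2]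
  simp only [mulVecFun, Matrix.mulVec_mulVec, adj]
  rw [← Matrix.star_eq_conjTranspose, (Unitary.mem_iff.1 hu).2, Matrix.one_mulVec]

theorem mem_modelSpace (hΘ : IsInner Θ) {f : LpVec n 2} :
    f ∈ modelSpace hΘ ↔ mulInnerAdj hΘ 2 f ∈ conjHardyZero n 2 ∧ f ∈ hardy n 2 := by
  refine and_congr_left fun _ => ⟨?_, fun h => ⟨_, h, mulInner_mulInnerAdj hΘ f⟩⟩
  rintro ⟨g, hg, rfl⟩
  rwa [mulInnerAdj_mulInner]

theorem inner_mulInner (hΘ : IsInner Θ) (f g : LpVec n 2) :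
    inner ℂ (mulInner hΘ 2 f) (mulInner hΘ 2 g) = inner ℂ f g :=
  LinearIsometry.inner_map_map (⟨mulInner hΘ 2, norm_mulInner hΘ 2⟩ : LpVec n 2 →ₗᵢ[ℂ] LpVec n 2)
    f g

theorem inner_expLp (k : ℤ) (v : Cn n) (g : LpVec n 2) :
    inner ℂ (expLp 2 k v) g = inner ℂ v (fourierCoeff g k) := by
  rw [fourierCoeff, ← integral_inner ((integrable_LpVec g).fourier_smul (-k)), L2.inner_def]
  refine integral_congr_ae ?_
  filter_upwards [coeFn_expLp (s := 2) k v] with t h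
  rw [h, inner_smul_left, inner_smul_right, fourier_neg]

theorem inner_eq_zero_of_mem_hardy {f g : LpVec n 2} (hf : f ∈ hardy n 2)
    (hg : g ∈ conjHardyZero n 2) : inner ℂ g f = 0 := by
  refine eq_zero_on_hardy (by norm_num) le_rfl (innerSL ℂ g) (fun k v hk => ?_) hf
  rw [innerSL_apply_apply, ← inner_conj_symm, inner_expLp, mem_conjHardyZero.1 hg k hk,
    inner_zero_right, map_zero]

/-- The Riesz projection on `(L²)ⁿ`. -/
abbrev riesz₂ : LpVec n 2 →L[ℂ] hardy n 2 := riesz (by norm_num) le_rfl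

/-- `P_Θ = P_{2+} - Θ P_{2+} Θ^*`. -/
theorem orthogonalProjection_modelSpace (hΘ : IsInner Θ) (w : LpVec n 2) :
    ((modelSpace hΘ).orthogonalProjectionOnto w : LpVec n 2) =
      riesz₂ w - mulInner hΘ 2 (riesz₂ (mulInnerAdj hΘ 2 w)) := by
  obtain ⟨h1, h2⟩ := isRieszProj_riesz (by norm_num) le_rfl w
  obtain ⟨h3, h4⟩ := isRieszProj_riesz (by norm_num) le_rfl (mulInnerAdj hΘ 2 w)
  refine Submodule.eq_starProjection_of_mem_orthogonal
    (K := modelSpace hΘ) (u := w) ?_ ?_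
  · refine (mem_modelSpace hΘ).2 ⟨?_, Submodule.sub_mem _ h1
      (mulInner_mem_hardy hΘ (by norm_num) le_rfl h3)⟩
    -- `Θ^*` maps the candidate to `(Θ^* w - P_{2+} Θ^* w) - Θ^* (w - P_{2+} w)`. Both terms are
    -- co-analytic, as `Θ^*` preserves co-analyticity.
    rw [map_sub, mulInnerAdj_mulInner]
    have := Submodule.sub_mem _ h4 (mulInnerAdj_mem_conjHardyZero hΘ (by norm_num) le_rfl h2)
    rw [map_sub] at this
    convert this using 1
    abel
  · rw [Submodule.mem_orthogonal]
    intro k hk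
    obtain ⟨hk1, hk2⟩ := (mem_modelSpace hΘ).1 hk
    -- The first summand is co-analytic, hence orthogonal to `k ∈ (H²)ⁿ`. For the second, `⟨k, Θ h⟩
    -- = ⟨Θ^* k, h⟩`, where `Θ^* k` is co-analytic and `h` analytic.
    have e : w - (riesz₂ w - mulInner hΘ 2 (riesz₂ (mulInnerAdj hΘ 2 w)) : LpVec n 2) =
        (w - riesz₂ w) + mulInner hΘ 2 (riesz₂ (mulInnerAdj hΘ 2 w)) := by abel
    rw [e, inner_add_right, ← inner_conj_symm, inner_eq_zero_of_mem_hardy hk2 h2, map_zero,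
      zero_add]
    nth_rw 1 [← mulInner_mulInnerAdj hΘ k]
    rw [inner_mulInner]
    exact inner_eq_zero_of_mem_hardy h3 hk1

/-! ### Bounded functions are dense in the model space -/

theorem memLp_top_expLp {s : ℝ≥0∞} [Fact (1 ≤ s)] (k : ℤ) (v : Cn n) :
    MemLp (expLp s k v) ∞ mC := by
  refine (memLp_congr_ae (coeFn_expLp (s := s) k v)).2 (MemLp.of_bound
    ((map_continuous (fourier k)).smul continuous_const).aestronglyMeasurable ‖v‖
    (Filter.Eventually.of_forall fun t => ?_))
  rw [norm_smul, fourier_apply, Circle.norm_coe, one_mul]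

theorem memLp_top_sub {s : ℝ≥0∞} {f g : LpVec n s} (hf : MemLp f ∞ mC) (hg : MemLp g ∞ mC) :
    MemLp (f - g : LpVec n s) ∞ mC :=
  (memLp_congr_ae (Lp.coeFn_sub f g)).2 (hf.sub hg)

theorem memLp_top_mulInner (hΘ : IsInner Θ) {s : ℝ≥0∞} {f : LpVec n s} (hf : MemLp f ∞ mC) :
    MemLp (mulInner hΘ s f) ∞ mC :=
  (memLp_congr_ae (coeFn_mulLp hΘ.memLp s s f)).2 (hΘ.memLp.mulVecFun hf)

theorem LpVec_ext_fourierCoeff {s : ℝ≥0∞} [Fact (1 ≤ s)] {f g : LpVec n s}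
    (h : ∀ k, fourierCoeff f k = fourierCoeff g k) : f = g := by
  rw [← sub_eq_zero, Lp.eq_zero_iff_ae_eq_zero]
  refine ae_eq_zero_of_fourierCoeff (integrable_LpVec _) fun k => ?_
  change coeffLin n s k (f - g) = 0
  rw [map_sub, sub_eq_zero]
  exact h k

theorem memLp_top_of_fourierCoeff {s : ℝ≥0∞} [Fact (1 ≤ s)] {f : LpVec n s} (S : Finset ℤ)
    (h : ∀ k ∉ S, fourierCoeff f k = 0) : MemLp f ∞ mC := by
  have e : f = ∑ k ∈ S, expLp s k (fourierCoeff f k) := by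
    refine LpVec_ext_fourierCoeff fun k => ?_
    change _ = coeffLin n s k _
    rw [map_sum]
    change _ = ∑ j ∈ S, fourierCoeff (expLp s j (fourierCoeff f j)) k
    simp only [fourierCoeff_expLp]
    rw [Finset.sum_ite_eq]
    split_ifs with hk
    · rfl
    · exact h k hk
  rw [e]
  refine (memLp_congr_ae (Lp.coeFn_finsetSum S fun k => expLp s k (fourierCoeff f k))).2 ?_
  exact memLp_finsetSum' S fun k _ => memLp_top_expLp k _

/-- `Θ^*` has no positive frequencies, so the analytic part of `Θ^* z^j v` is a polynomial of degree
at most `j`. Thus `P_Θ (z^j v)` is `z^j v` minus `Θ` times a polynomial, and `Θ` is bounded. -/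
theorem memLp_top_orthogonalProjection_expLp (hΘ : IsInner Θ) {j : ℤ} (hj : 0 ≤ j) (v : Cn n) :
    MemLp ((modelSpace hΘ).orthogonalProjectionOnto (expLp 2 j v) : LpVec n 2) ∞ mC := by
  rw [orthogonalProjection_modelSpace]
  obtain ⟨h1, h2⟩ := isRieszProj_riesz (by norm_num) le_rfl (mulInnerAdj hΘ 2 (expLp 2 j v))
  refine memLp_top_sub ?_ (memLp_top_mulInner hΘ
    (memLp_top_of_fourierCoeff (Finset.Icc 0 j) fun k hk => ?_))
  · rw [riesz_eq _ _ (isRieszProj_of_mem_hardy (expLp_mem_hardy hj v))]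
    exact memLp_top_expLp j v
  · rcases lt_or_ge k 0 with hk0 | hk0
    · exact mem_hardy.1 h1 k hk0
    · have hkj : j < k := by
        by_contra hc
        exact hk (Finset.mem_Icc.2 ⟨hk0, not_lt.1 hc⟩)
      have h3 : coeffLin n 2 k _ = 0 := mem_conjHardyZero.1 h2 k hk0
      rw [map_sub, sub_eq_zero] at h3
      refine h3.symm.trans ?_
      ext i
      refine (fourierCoeff_mulLp_expLp hΘ.memLp.adj 2 2 le_top j k v i).trans ?_
      exact Finset.sum_eq_zero fun l _ => by rw [fourierCoeff_adj hΘ i l (by lia), zero_mul]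

/-- The bounded functions in the model space. -/
def boundedModel (hΘ : IsInner Θ) : Submodule ℂ (modelSpace hΘ) where
  carrier := {f | MemLp (f : LpVec n 2) ∞ mC}
  add_mem' {f g} hf hg := (memLp_congr_ae (Lp.coeFn_add (f : LpVec n 2) g)).2 (hf.add hg)
  zero_mem' := (memLp_congr_ae (Lp.coeFn_zero (Cn n) 2 mC)).2 MemLp.zero
  smul_mem' z f hf := (memLp_congr_ae (Lp.coeFn_smul z (f : LpVec n 2))).2 (hf.const_smul z)

/-- An element `k` of `K_Θ` orthogonal to all bounded ones is orthogonal to every `P_Θ (z^j v)` with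
`j ≥ 0`, hence to `z^j v`. Its coefficients of index at least `0` then vanish, and it is analytic as
well, so it is zero. -/
theorem dense_boundedModel (hΘ : IsInner Θ) :
    Dense (boundedModel hΘ : Set (modelSpace hΘ)) := by
  rw [Submodule.dense_iff_topologicalClosure_eq_top, Submodule.topologicalClosure_eq_top_iff,
    Submodule.eq_bot_iff]
  intro k hk
  rw [Submodule.mem_orthogonal] at hk
  refine Subtype.ext (eq_zero_of_mem_hardy_of_mem_conjHardyZero k.2.2
    (mem_conjHardyZero.2 fun j hj => ?_))
  refine ext_inner_left ℂ fun v => ?_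
  rw [← inner_expLp, inner_zero_right,
    ← Submodule.inner_orthogonalProjectionOnto_eq_of_mem_right k]
  exact hk _ (memLp_top_orthogonalProjection_expLp hΘ hj v)

end InnerFunctions

/-! ### The inclusion of `(L²)ⁿ` into `(L^q)ⁿ` -/

section Inclusion

variable {n : ℕ} {Θ G : Circ → Matrix (Fin n) (Fin n) ℂ} {p q : ℝ≥0∞}
  [ENNReal.HolderTriple p 2 q] [Fact (1 ≤ q)]

/-- Allows the inclusion of `(L²)ⁿ` into `(L^q)ⁿ` to be treated as multiplication by the identity
symbol, so that Hölder's inequality gives its boundedness. -/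
theorem matrixMemLp_one (n : ℕ) (p : ℝ≥0∞) :
    MatrixMemLp (fun _ => (1 : Matrix (Fin n) (Fin n) ℂ)) p :=
  fun i j => memLp_const ((1 : Matrix (Fin n) (Fin n) ℂ) i j)

/-- The inclusion of `(L²)ⁿ` into `(L^q)ⁿ`. -/
def inclL (n : ℕ) (p q : ℝ≥0∞) [ENNReal.HolderTriple p 2 q] [Fact (1 ≤ q)] :
    LpVec n 2 →L[ℂ] LpVec n q :=
  mulL (matrixMemLp_one n p) 2 q

theorem coeFn_inclL (f : LpVec n 2) : inclL n p q f =ᵐ[mC] f := by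
  filter_upwards [coeFn_mulLp (matrixMemLp_one n p) 2 q f] with t ht
  rw [inclL, mulL_apply, ht, mulVecFun, Matrix.one_mulVec]

/-- Analyticity and co-analyticity are conditions on Fourier coefficients alone, so the Riesz
projections for different exponents are compatible. -/
theorem isRieszProj_inclL {f g : LpVec n 2} (h : IsRieszProj f g) :
    IsRieszProj (inclL n p q f) (inclL n p q g) := by
  refine ⟨mem_hardy.2 fun k hk => ?_, ?_⟩
  · rw [fourierCoeff_congr_ae (coeFn_inclL g)]
    exact mem_hardy.1 h.1 k hk
  · rw [← map_sub]
    refine mem_conjHardyZero.2 fun k hk => ?_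
    rw [fourierCoeff_congr_ae (coeFn_inclL (f - g))]
    exact mem_conjHardyZero.1 h.2 k hk

theorem mulLp_inclL {M : Circ → Matrix (Fin n) (Fin n) ℂ} (hM : MatrixMemLp M ∞)
    (f : LpVec n 2) : mulLp hM q q (inclL n p q f) = inclL n p q (mulLp hM 2 2 f) := by
  refine Lp.ext ?_
  filter_upwards [coeFn_mulLp hM q q (inclL n p q f), coeFn_mulLp hM 2 2 f,
    coeFn_inclL (p := p) (q := q) f, coeFn_inclL (p := p) (q := q) (mulLp hM 2 2 f)]
    with t h1 h2 h3 h4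
  rw [h1, h4, h2, mulVecFun, mulVecFun, h3]

/-- `P_{q+} (G k) = A k + Θ P_{q+} (Θ^* G k)` for `k` in the model space. -/
theorem riesz_mulLp_modelSpace (hp : 2 ≤ p) (hq1 : 1 < q) (hq2 : q ≤ 2) (hΘ : IsInner Θ)
    (hG : MatrixMemLp G p) {A : modelSpace hΘ →L[ℂ] modelSpace hΘ}
    (hA : IsMTTO hΘ (hG.mono hp) A) (k : modelSpace hΘ) :
    (riesz hq1 hq2 (mulLp hG 2 q (k : LpVec n 2)) : LpVec n q) =
      inclL n p q (A k) + mulInner hΘ q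
        (riesz hq1 hq2 (mulInnerAdj hΘ q (mulLp hG 2 q (k : LpVec n 2)))) := by
  let L : modelSpace hΘ →L[ℂ] LpVec n q :=
    (hardy n q).subtypeL ∘L riesz hq1 hq2 ∘L mulL hG 2 q ∘L (modelSpace hΘ).subtypeL
  let R : modelSpace hΘ →L[ℂ] LpVec n q :=
    inclL n p q ∘L (modelSpace hΘ).subtypeL ∘L A + mulL hΘ.memLp q q ∘L (hardy n q).subtypeL ∘L
      riesz hq1 hq2 ∘L mulL hΘ.memLp.adj q q ∘L mulL hG 2 q ∘L (modelSpace hΘ).subtypeL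
  -- Both sides are bounded into `(L^q)ⁿ`, so bounded `f` suffice. For those `Gf` lies in `(L²)ⁿ`,
  -- where `A f` is given by `P_Θ (G f)` and the formula for `P_Θ` applies.
  have hLR : L = R := by
    refine ContinuousLinearMap.ext_on ((dense_boundedModel hΘ).mono Submodule.subset_span)
      fun f hf => ?_
    have hf' : MemLp (f : LpVec n 2) ∞ mC := hf
    set w : LpVec n 2 := ((hG.mono hp).mulVecFun hf' :
      MemLp (mulVecFun G (f : LpVec n 2)) 2 mC).toLp _ with hw
    have hGw : mulLp hG 2 q (f : LpVec n 2) = inclL n p q w := by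
      refine Lp.ext ?_
      filter_upwards [coeFn_mulLp hG 2 q (f : LpVec n 2), coeFn_inclL (p := p) (q := q) w,
        ((hG.mono hp).mulVecFun hf' : MemLp (mulVecFun G (f : LpVec n 2)) 2 mC).coeFn_toLp]
        with t h1 h2 h3
      rw [h1, h2, h3]
    have hin : ∀ f : LpVec n 2,
        mulInner hΘ q (inclL n p q f) = inclL n p q (mulInner hΘ 2 f) := mulLp_inclL hΘ.memLp
    have had : mulInnerAdj hΘ q (inclL n p q w) = inclL n p q (mulInnerAdj hΘ 2 w) :=
      mulLp_inclL hΘ.memLp.adj w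
    have h1 := riesz_eq hq1 hq2 (isRieszProj_inclL (p := p) (q := q)
      (isRieszProj_riesz (by norm_num) le_rfl w))
    have h2 := riesz_eq hq1 hq2 (isRieszProj_inclL (p := p) (q := q)
      (isRieszProj_riesz (by norm_num) le_rfl (mulInnerAdj hΘ 2 w)))
    change (riesz hq1 hq2 (mulLp hG 2 q (f : LpVec n 2)) : LpVec n q) =
      inclL n p q (A f) + mulInner hΘ q
        (riesz hq1 hq2 (mulInnerAdj hΘ q (mulLp hG 2 q (f : LpVec n 2))))
    rw [hGw, h1, hA f hf', ← hw, orthogonalProjection_modelSpace, had, h2, hin, map_sub,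
      sub_add_cancel]
  exact DFunLike.congr_fun hLR k

end Inclusion

/-! ### Coordinates on Co-d and the equivalence after extension -/

instance instCompleteHardy (n : ℕ) (s : ℝ≥0∞) [Fact (1 ≤ s)] : CompleteSpace (hardy n s) :=
  (isClosed_hardy n s).completeSpace_coe

section Coordinates

variable {n : ℕ} {Θ G : Circ → Matrix (Fin n) (Fin n) ℂ} {p q : ℝ≥0∞}
  [ENNReal.HolderTriple p 2 q] [Fact (1 ≤ q)] (hq1 : 1 < q) (hq2 : q ≤ 2)
  (hΘ : IsInner Θ) (hG : MatrixMemLp G p)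

/-- The second coordinate `Θ p₁ + p₂ + P_{q+} (G Θ p₃)` of an element of Co-d. -/
def coDSnd : modelSpace hΘ × hardy n q × hardy n 2 →ₗ[ℂ] LpVec n q :=
  mulInner hΘ q ∘ₗ (hardy n q).subtype ∘ₗ LinearMap.fst ℂ _ _ ∘ₗ LinearMap.snd ℂ _ _ +
  (inclL n p q).toLinearMap ∘ₗ (modelSpace hΘ).subtype ∘ₗ LinearMap.fst ℂ _ _ +
  (hardy n q).subtype ∘ₗ (riesz hq1 hq2).toLinearMap ∘ₗ mulLp hG 2 q ∘ₗ mulInner hΘ 2 ∘ₗ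
    (hardy n 2).subtype ∘ₗ LinearMap.snd ℂ _ _ ∘ₗ LinearMap.snd ℂ _ _

theorem coDSnd_apply (x : modelSpace hΘ × hardy n q × hardy n 2) :
    coDSnd hq1 hq2 hΘ hG x = mulInner hΘ q x.2.1 + inclL n p q x.1 +
      riesz hq1 hq2 (mulLp hG 2 q (mulInner hΘ 2 x.2.2)) := rfl

theorem coDSnd_mem (x : modelSpace hΘ × hardy n q × hardy n 2) :
    coDSnd hq1 hq2 hΘ hG x ∈ hardy n q :=
  Submodule.add_mem _ (Submodule.add_mem _ (mulInner_mem_hardy hΘ hq1 hq2 x.2.1.2)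
    (isRieszProj_inclL (p := p) (isRieszProj_of_mem_hardy x.1.2.2)).1) (Subtype.mem _)

theorem coDRep_coDSnd (x : modelSpace hΘ × hardy n q × hardy n 2) :
    CoDRep hΘ hG q x.2.2 ⟨coDSnd hq1 hq2 hΘ hG x, coDSnd_mem hq1 hq2 hΘ hG x⟩
      (mulInner hΘ q x.2.1) x.1 := by
  refine ⟨⟨_, x.2.1.2, rfl⟩, x.1.2, _, isRieszProj_riesz hq1 hq2 _, ?_⟩
  change (coDSnd hq1 hq2 hΘ hG x : Circ → Cn n) =ᵐ[mC] _
  rw [coDSnd_apply]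
  filter_upwards [Lp.coeFn_add (mulInner hΘ q x.2.1 + inclL n p q x.1)
    (riesz hq1 hq2 (mulLp hG 2 q (mulInner hΘ 2 x.2.2)) : LpVec n q),
    Lp.coeFn_add (mulInner hΘ q (x.2.1 : LpVec n q)) (inclL n p q x.1),
    coeFn_inclL (p := p) (q := q) (x.1 : LpVec n 2)] with t h1 h2 h3
  rw [h1, Pi.add_apply, h2, Pi.add_apply, h3]

/-- The coordinates `(p₂, p₁, p₃)` on Co-d, as a linear map. -/
def coDLin : modelSpace hΘ × hardy n q × hardy n 2 →ₗ[ℂ] CoD hΘ hG q where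
  toFun x := ⟨(x.2.2, ⟨coDSnd hq1 hq2 hΘ hG x, coDSnd_mem hq1 hq2 hΘ hG x⟩), _, _,
    coDRep_coDSnd hq1 hq2 hΘ hG x⟩
  map_add' x y := Subtype.ext (Prod.ext rfl (Subtype.ext (map_add (coDSnd hq1 hq2 hΘ hG) x y)))
  map_smul' z x := Subtype.ext (Prod.ext rfl (Subtype.ext (map_smul (coDSnd hq1 hq2 hΘ hG) z x)))

theorem norm_coDLin (x : modelSpace hΘ × hardy n q × hardy n 2) :
    ‖coDLin hq1 hq2 hΘ hG x‖ = ‖x.2.1‖ + ‖x.1‖ + ‖x.2.2‖ := by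
  rw [CoD.norm_eq (x := coDLin hq1 hq2 hΘ hG x) (coDRep_coDSnd hq1 hq2 hΘ hG x), norm_mulInner]
  rfl

theorem coDLin_surjective : Function.Surjective (coDLin hq1 hq2 hΘ hG) := by
  intro x
  obtain ⟨⟨p₁, hp₁, e₁⟩, hp₂, h, hh, e⟩ := x.rep
  refine ⟨(⟨x.model, hp₂⟩, ⟨p₁, hp₁⟩, x.fst), Subtype.ext (Prod.ext rfl (Subtype.ext (Lp.ext ?_)))⟩
  have e2 := (coDRep_coDSnd hq1 hq2 hΘ hG (⟨x.model, hp₂⟩, ⟨p₁, hp₁⟩, x.fst)).right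
  obtain ⟨h', hh', e'⟩ := e2
  -- The decomposition of `x` contains some Riesz projection of `G Θ p₃`; by uniqueness it is the
  -- one used in the coordinates.
  obtain rfl := hh.unique hh'
  refine e'.trans (Filter.EventuallyEq.trans ?_ e.symm)
  rw [← e₁]

theorem coDLin_bijective : Function.Bijective (coDLin hq1 hq2 hΘ hG) := by
  refine ⟨(injective_iff_map_eq_zero _).2 fun x hx => ?_, coDLin_surjective hq1 hq2 hΘ hG⟩
  have h := norm_coDLin hq1 hq2 hΘ hG x
  rw [hx, norm_zero] at h
  have h1 := norm_nonneg x.1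
  have h2 := norm_nonneg x.2.1
  have h3 := norm_nonneg x.2.2
  exact Prod.ext (norm_eq_zero.1 (by linarith)) (Prod.ext (norm_eq_zero.1 (by linarith))
    (norm_eq_zero.1 (by linarith)))

/-- The product carries the maximum of the three norms and Co-d their sum, whence the constants `3`
and `1` in the two bounds. -/
theorem norm_coDLin_le (x : modelSpace hΘ × hardy n q × hardy n 2) :
    ‖coDLin hq1 hq2 hΘ hG x‖ ≤ 3 * ‖x‖ := by
  rw [norm_coDLin]
  have h1 := norm_fst_le x
  have h2 := (norm_fst_le x.2).trans (norm_snd_le x)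
  have h3 := (norm_snd_le x.2).trans (norm_snd_le x)
  linarith

theorem norm_le_norm_coDLin (x : modelSpace hΘ × hardy n q × hardy n 2) :
    ‖x‖ ≤ ‖coDLin hq1 hq2 hΘ hG x‖ := by
  rw [norm_coDLin]
  have h1 := norm_nonneg x.1
  have h2 := norm_nonneg x.2.1
  have h3 := norm_nonneg x.2.2
  exact max_le (by linarith) (max_le (by linarith) (by linarith))

/-- The coordinates `(p₂, p₁, p₃)` on Co-d. -/
def coDEquiv : (modelSpace hΘ × hardy n q × hardy n 2) ≃L[ℂ] CoD hΘ hG q :=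
  (LinearEquiv.ofBijective (coDLin hq1 hq2 hΘ hG)
    (coDLin_bijective hq1 hq2 hΘ hG)).toContinuousLinearEquivOfBounds 3 1
    (norm_coDLin_le hq1 hq2 hΘ hG) fun y => by
      obtain ⟨x, rfl⟩ := (LinearEquiv.ofBijective (coDLin hq1 hq2 hΘ hG)
        (coDLin_bijective hq1 hq2 hΘ hG)).surjective y
      rw [LinearEquiv.symm_apply_apply, one_mul]
      exact norm_le_norm_coDLin hq1 hq2 hΘ hG x

theorem completeSpace_coD {n : ℕ} {Θ G : Circ → Matrix (Fin n) (Fin n) ℂ} {p q : ℝ≥0∞}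
    [ENNReal.HolderTriple p 2 q] [Fact (1 ≤ q)] (hq1 : 1 < q) (hq2 : q ≤ 2) (hΘ : IsInner Θ)
    (hG : MatrixMemLp G p) : CompleteSpace (CoD hΘ hG q) :=
  (completeSpace_congr (e := (coDEquiv hq1 hq2 hΘ hG).symm.toEquiv)
    (coDEquiv hq1 hq2 hΘ hG).symm.isUniformEmbedding).2 inferInstance

/-! ### Coordinates on the domain and factorisation of the Toeplitz operator -/

/-- The operator `k ↦ P_{q+} (Θ^* G k)` on the model space. -/
def cornerL : modelSpace hΘ →L[ℂ] hardy n q :=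
  riesz hq1 hq2 ∘L mulL hΘ.memLp.adj q q ∘L mulL hG 2 q ∘L (modelSpace hΘ).subtypeL

/-- Multiplication by `Θ` on `(H²)ⁿ`. -/
def hardyMulInner : hardy n 2 →L[ℂ] hardy n 2 :=
  (mulL hΘ.memLp 2 2 ∘L (hardy n 2).subtypeL).codRestrict _ fun f =>
    mulInner_mem_hardy hΘ (by norm_num) le_rfl f.2

/-- The operator `f ↦ P_{2+} (Θ^* f)` on `(H²)ⁿ`. -/
def hardyMulInnerAdj : hardy n 2 →L[ℂ] hardy n 2 :=
  riesz₂ ∘L mulL hΘ.memLp.adj 2 2 ∘L (hardy n 2).subtypeL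

/-- The orthogonal projection of `(H²)ⁿ` onto the model space. -/
def hardyToModel : hardy n 2 →L[ℂ] modelSpace hΘ :=
  (modelSpace hΘ).orthogonalProjectionOnto ∘L (hardy n 2).subtypeL

/-- The inclusion of the model space into `(H²)ⁿ`. -/
def modelToHardy : modelSpace hΘ →L[ℂ] hardy n 2 :=
  (modelSpace hΘ).subtypeL.codRestrict _ fun f => f.2.2

/-- On `(H²)ⁿ` the projection `P_{2+}` is the identity, so the formula for `P_Θ` becomes the
decomposition `(H²)ⁿ = K_Θ ⊕ Θ(H²)ⁿ`. The next two lemmas recover its components. -/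
theorem modelToHardy_add_hardyMulInner (f : hardy n 2) :
    modelToHardy hΘ (hardyToModel hΘ f) + hardyMulInner hΘ (hardyMulInnerAdj hΘ f) = f := by
  refine Subtype.ext ?_
  change ((modelSpace hΘ).orthogonalProjectionOnto (f : LpVec n 2) : LpVec n 2) +
    mulInner hΘ 2 (riesz₂ (mulInnerAdj hΘ 2 f)) = f
  rw [orthogonalProjection_modelSpace, riesz_eq _ _ (isRieszProj_of_mem_hardy f.2), sub_add_cancel]

theorem hardyMulInnerAdj_add (k : modelSpace hΘ) (h : hardy n 2) :
    hardyMulInnerAdj hΘ (modelToHardy hΘ k + hardyMulInner hΘ h) = h := by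
  refine Subtype.ext ?_
  refine riesz_eq (f := mulInnerAdj hΘ 2 ((k : LpVec n 2) + mulInner hΘ 2 h))
    (by norm_num) le_rfl ⟨h.2, ?_⟩
  rw [map_add, mulInnerAdj_mulInner, add_sub_cancel_right]
  exact ((mem_modelSpace hΘ).1 k.2).1

theorem hardyToModel_add (k : modelSpace hΘ) (h : hardy n 2) :
    hardyToModel hΘ (modelToHardy hΘ k + hardyMulInner hΘ h) = k := by
  have e := modelToHardy_add_hardyMulInner hΘ (modelToHardy hΘ k + hardyMulInner hΘ h)
  rw [hardyMulInnerAdj_add] at e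
  exact Subtype.ext (congrArg (fun f : hardy n 2 => (f : LpVec n 2)) (add_right_cancel e))

/-- The invertible operator `(k, a, h) ↦ (k + Θ h, a - P_{q+} (Θ^* G k))`. -/
def domEquiv : (modelSpace hΘ × hardy n q × hardy n 2) ≃L[ℂ] hardy n 2 × hardy n q :=
  ContinuousLinearEquiv.equivOfInverse
    (((modelToHardy hΘ).coprod (hardyMulInner hΘ ∘L ContinuousLinearMap.snd ℂ _ _)).prod
      ((-cornerL hq1 hq2 hΘ hG).coprod (ContinuousLinearMap.fst ℂ _ _)))
    ((hardyToModel hΘ ∘L ContinuousLinearMap.fst ℂ _ _).prod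
      (((cornerL hq1 hq2 hΘ hG ∘L hardyToModel hΘ).coprod (ContinuousLinearMap.id ℂ _)).prod
        (hardyMulInnerAdj hΘ ∘L ContinuousLinearMap.fst ℂ _ _)))
    (fun x => by
      refine Prod.ext ?_ (Prod.ext ?_ ?_)
      · exact hardyToModel_add hΘ _ _
      · change cornerL hq1 hq2 hΘ hG (hardyToModel hΘ (modelToHardy hΘ x.1 +
          hardyMulInner hΘ x.2.2)) + (-cornerL hq1 hq2 hΘ hG x.1 + x.2.1) = x.2.1
        rw [hardyToModel_add, add_neg_cancel_left]
      · exact hardyMulInnerAdj_add hΘ _ _)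
    (fun x => by
      refine Prod.ext ?_ ?_
      · exact modelToHardy_add_hardyMulInner hΘ _
      · exact neg_add_cancel_left _ _)

/-- The Toeplitz operator with restricted codomain, in coordinates `A ⊕ I`. -/
def restrictedToeplitz (A : modelSpace hΘ →L[ℂ] modelSpace hΘ) :
    Sum1 (hardy n 2) (hardy n q) →L[ℂ] CoD hΘ hG q :=
  (coDEquiv hq1 hq2 hΘ hG).toContinuousLinearMap ∘L
    A.prodMap (ContinuousLinearMap.id ℂ (hardy n q × hardy n 2)) ∘L
    (domEquiv hq1 hq2 hΘ hG).symm.toContinuousLinearMap ∘L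
    (WithLp.prodContinuousLinearEquiv 1 ℂ (hardy n 2) (hardy n q)).toContinuousLinearMap

/-- The first component is the coordinate `h` by construction. For the second, `f₁ = k + Θh` gives
`P_{q+}(G f₁ + Θ f₂) = P_{q+}(Gk) + P_{q+}(GΘh) + Θ f₂`. The key identity splits `P_{q+}(Gk)` into
the model part `Ak` and a term of `Θ(H^q)ⁿ` that joins `Θ f₂`. -/
theorem isRestrictedToeplitz_restrictedToeplitz (hp : 2 ≤ p)
    {A : modelSpace hΘ →L[ℂ] modelSpace hΘ} (hA : IsMTTO hΘ (hG.mono hp) A) :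
    IsRestrictedToeplitz hΘ hG q (restrictedToeplitz hq1 hq2 hΘ hG A) := by
  intro f₁ f₂
  refine ⟨isRieszProj_riesz (by norm_num) le_rfl _, ?_⟩
  set k := hardyToModel hΘ f₁ with hk
  set h := hardyMulInnerAdj hΘ f₁ with hh
  have hsnd : ((restrictedToeplitz hq1 hq2 hΘ hG A (WithLp.toLp 1 (f₁, f₂))).snd : LpVec n q) =
      mulInner hΘ q ((cornerL hq1 hq2 hΘ hG k + f₂ : hardy n q) : LpVec n q) +
        inclL n p q (A k) + riesz hq1 hq2 (mulLp hG 2 q (mulInner hΘ 2 h)) := rfl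
  have hf₁ : (f₁ : LpVec n 2) = k + mulInner hΘ 2 h :=
    (congrArg Subtype.val (modelToHardy_add_hardyMulInner hΘ f₁)).symm
  have key := riesz_mulLp_modelSpace hp hq1 hq2 hΘ hG hA k
  have hcorner : (cornerL hq1 hq2 hΘ hG k : LpVec n q) =
    riesz hq1 hq2 (mulInnerAdj hΘ q (mulLp hG 2 q (k : LpVec n 2))) := rfl
  have hres : (riesz hq1 hq2 (mulLp hG 2 q (f₁ : LpVec n 2) + mulInner hΘ q (f₂ : LpVec n q)) :
      LpVec n q) = (restrictedToeplitz hq1 hq2 hΘ hG A (WithLp.toLp 1 (f₁, f₂))).snd := by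
    rw [hsnd, hf₁, map_add, map_add, map_add, Submodule.coe_add, Submodule.coe_add, key,
      Submodule.coe_add, map_add, hcorner,
      riesz_eq hq1 hq2 (isRieszProj_of_mem_hardy (mulInner_mem_hardy hΘ hq1 hq2 f₂.2))]
    abel
  rw [← hres]
  exact isRieszProj_riesz hq1 hq2 _

theorem equivAfterExt_restrictedToeplitz (A : modelSpace hΘ →L[ℂ] modelSpace hΘ) :
    EquivAfterExt (Y := Sum1 (hardy n 2) (hardy n q)) (Y' := CoD hΘ hG q) A
      (restrictedToeplitz hq1 hq2 hΘ hG A) := by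
  -- Only `A` needs extending. `E` reads off the coordinates of Co-d and `F` is `domEquiv`, so both
  -- cancel against the factors in the definition of the operator.
  refine ⟨hardy n q × hardy n 2, PUnit, inferInstance, inferInstance, inferInstance,
    inferInstance, inferInstance, inferInstance,
    (WithLp.prodContinuousLinearEquiv 1 ℂ _ _).trans
      ((ContinuousLinearEquiv.prodUnique ℂ _ _).trans ((coDEquiv hq1 hq2 hΘ hG).symm.trans
        (WithLp.prodContinuousLinearEquiv 1 ℂ _ _).symm)),
    (WithLp.prodContinuousLinearEquiv 1 ℂ _ _).trans ((domEquiv hq1 hq2 hΘ hG).trans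
      ((WithLp.prodContinuousLinearEquiv 1 ℂ _ _).symm.trans
        ((ContinuousLinearEquiv.prodUnique ℂ _ PUnit).symm.trans
          (WithLp.prodContinuousLinearEquiv 1 ℂ _ _).symm))), fun x x₀ => ?_⟩
  change WithLp.toLp 1 (A x, x₀) = WithLp.toLp 1 ((coDEquiv hq1 hq2 hΘ hG).symm
    (coDEquiv hq1 hq2 hΘ hG (A.prodMap (ContinuousLinearMap.id ℂ (hardy n q × hardy n 2))
      ((domEquiv hq1 hq2 hΘ hG).symm (domEquiv hq1 hq2 hΘ hG (x, x₀))))))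
  rw [ContinuousLinearEquiv.symm_apply_apply, ContinuousLinearEquiv.symm_apply_apply]
  rfl

end Coordinates

end MTTO

end

theorem mainTheorem3 (n : ℕ) (Θ G : MTTO.Circ → Matrix (Fin n) (Fin n) ℂ)
    (p q : ℝ≥0∞) (hp : 2 < p) [ENNReal.HolderTriple p 2 q] [Fact (1 ≤ q)]
    (hΘ : MTTO.IsInner Θ) (hG : MTTO.MatrixMemLp G p)
    (A : MTTO.modelSpace hΘ →L[ℂ] MTTO.modelSpace hΘ)
    (hA : MTTO.IsMTTO hΘ (hG.mono hp.le) A) :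
    CompleteSpace (MTTO.CoD hΘ hG q) ∧
    ∃ T : MTTO.Sum1 (MTTO.hardy n 2) (MTTO.hardy n q) →L[ℂ] MTTO.CoD hΘ hG q,
      MTTO.IsRestrictedToeplitz hΘ hG q T ∧ MTTO.EquivAfterExt (Y := MTTO.Sum1 (MTTO.hardy n 2) (MTTO.hardy n q))
        (Y' := MTTO.CoD hΘ hG q) A T := by
  have hpq := ENNReal.HolderTriple.inv_add_inv_eq_inv p 2 q
  -- The strict inequality `p > 2` keeps `q` away from the endpoint `1`, where the Riesz projection
  -- is unbounded.
  have hq1 : 1 < q := by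
    rw [← ENNReal.inv_lt_one, ← hpq, ← ENNReal.inv_two_add_inv_two]
    exact ENNReal.add_lt_add_right (by simp) (ENNReal.inv_lt_inv.2 hp)
  have hq2 : q ≤ 2 := by
    rw [← ENNReal.inv_le_inv, ← hpq]
    exact le_add_self
  exact ⟨MTTO.completeSpace_coD hq1 hq2 hΘ hG, MTTO.restrictedToeplitz hq1 hq2 hΘ hG A,
    MTTO.isRestrictedToeplitz_restrictedToeplitz hq1 hq2 hΘ hG hp.le hA,
    MTTO.equivAfterExt_restrictedToeplitz hq1 hq2 hΘ hG A⟩
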